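/- Let $(\mathtt C,\otimes,\mathds 1,\tau)$ be an additive symmetric monoidal category whose tensor product is additive in each variable, and in which the free monoids $T(M)=T_{\mathds 1}(M)=\bigoplus_{n\ge 0}M^{\otimes n}$ can be formed: for every object $M$ the coproduct $\bigoplus_{n\ge0}M^{\otimes n}$ exists and is preserved by every functor $X\otimes-$. Equip $T(M)$ with the concatenation product, and let $M\to T(M)$ be the inclusion of the generators. Let $\Sigma$ be an invertible object of $\mathtt C$, i.e. there are an object $\Sigma^-$ and an isomorphism $\Sigma^-\otimes\Sigma\cong\mathds 1$, and write $\Sigma A=\Sigma\otimes A$. A $\Sigma$-double bracket on an object $A$ is a morphism $f:\Sigma A\otimes\Sigma A\to\Sigma A\otimes A$. * It is antisymmetric if $f=-(\Sigma\tau_{A,A})\,f\,\tau_{\Sigma A,\Sigma A}$. * It is a $\Sigma$-double Lie bracket if it is antisymmetric and, with $f_l=(f\otimes A)(\Sigma A\otimes f)$, the double jacobiator $$f_l+\Sigma\tau_{A,A\otimes A}\,f_l\,\tau_{\Sigma A\otimes\Sigma A,\Sigma A}+\Sigma\tau_{A\otimes A,A}\,f_l\,\tau_{\Sigma A,\Sigma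 A\otimes\Sigma A}:\ (\Sigma A)^{\otimes 3}\to\Sigma A\otimes A\otimes A$$ vanishes. * If $(A,\mu)$ is a monoid, $f$ has the left derivation property if $$f(\Sigma\mu\otimes\Sigma A)={}_A\mu^i(A\otimes f)(\tau_{\Sigma,A}\otimes A\otimes\Sigma A)+\mu^i_A(f\otimes A)(\Sigma A\otimes\tau_{A,\Sigma A}),$$ where ${}_A\mu^i=(\Sigma A\otimes\mu)(\tau_{A,\Sigma A}\otimes A)$ and $\mu^i_A=(\Sigma\mu\otimes A)(\Sigma A\otimes\tau_{A,A})$ are the inner actions of $A$ on $\Sigma A\otimes A$. * A $\Sigma$-double Poisson bracket on a monoid is a $\Sigma$-double Lie bracket with the left derivation property. A morphism $\varphi:(A,f)\to(B,g)$ is compatible with the brackets if $g(\Sigma\varphi\otimes\Sigma\varphi)=(\Sigma\varphi\otimes\varphi)f$. Let $\Sigma\text{-}\mathtt{DLie}_{\mathtt C}$ be the category of objects of $\mathtt C$ with a $\Sigma$-double Lie bracket and compatible morphisms. A $\Sigma$-double Poisson bracket on $T(M)$ is quadratic if its restrictions to $\Sigma\mathds 1\otimes\Sigma\mathds 1$ and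 $\Sigma M\otimes\Sigma\mathds 1$ are zero and its restriction to $\Sigma M\otimes\Sigma M$ takes values in $\Sigma M\otimes M$. Let $\Sigma\text{-}\mathtt{DPFree}^{quad}_{\mathds 1}$ be the category whose objects are the objects $M$ of $\mathtt C$ with a quadratic $\Sigma$-double Poisson bracket on $T(M)$, and whose morphisms from $M$ to $N$ are the monoid morphisms $T(M)\to T(N)$ that are compatible with the brackets and are of the form $T(\varphi)$ for some $\varphi:M\to N$ in $\mathtt C$. **Proposition.** For every $\Sigma$-double Lie algebra $(L,f)$ there is exactly one antisymmetric $\Sigma$-double bracket $\tilde f$ on $T(L)$ that has the left derivation property and extends $f$ (that is, the inclusion $L\to T(L)$ is compatible with $f$ and $\tilde f$). It is a quadratic $\Sigma$-double Poisson bracket. If $\varphi:L\to H$ is a morphism of $\Sigma$-double Lie algebras, then $T(\varphi)$ is compatible with the extended brackets. The resulting functor $$T_{\mathds 1}(-):\ \Sigma\text{-}\mathtt{DLie}_{\mathtt C}\longrightarrow\Sigma\text{-}\mathtt{DPFree}^{quad}_{\mathds 1},\qquad (L,f)\mapsto (T(L),\tilde f),\quad \varphi\mapsto T(\varphi),$$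 is an equivalence of categories, and the functor that restricts brackets and morphisms to the generators is an inverse of this equivalence. -/

import Mathlib

open CategoryTheory CategoryTheory.Limits CategoryTheory.MonoidalCategory

universe v u

namespace DoubleBrackets

/-! ### Double brackets in a symmetric monoidal preadditive category

`S` plays the role of the invertible object `Σ`, and `S ⊗ A` is `ΣA`. -/

section BracketHoms

variable {C : Type u} [Category.{v} C] [MonoidalCategory C]

/-- The type of `Σ`-double brackets on `A`, i.e. morphisms `ΣA ⊗ ΣA ⟶ ΣA ⊗ A`. -/
abbrev DoubleBracket (S A : C) : Type v := (S ⊗ A) ⊗ (S ⊗ A) ⟶ (S ⊗ A) ⊗ A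

/-- `φ` commutes with the double brackets. -/
def IsBracketHom (S : C) {A B : C} (f : DoubleBracket S A) (g : DoubleBracket S B) (φ : A ⟶ B) : Prop :=
  (S ◁ φ ⊗ₘ S ◁ φ) ≫ g = f ≫ (S ◁ φ ⊗ₘ φ)

lemma IsBracketHom.id (S : C) {A : C} (f : DoubleBracket S A) : IsBracketHom S f f (𝟙 A) := by
  simp [IsBracketHom]

lemma IsBracketHom.comp {S A B D : C} {f : DoubleBracket S A} {g : DoubleBracket S B}
    {h : DoubleBracket S D} {φ : A ⟶ B} {ψ : B ⟶ D} (hφ : IsBracketHom S f g φ)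
    (hψ : IsBracketHom S g h ψ) : IsBracketHom S f h (φ ≫ ψ) := by
  unfold IsBracketHom at *
  simp only [MonoidalCategory.whiskerLeft_comp, ← tensorHom_comp_tensorHom, Category.assoc]
  rw [hψ, reassoc_of% hφ]

end BracketHoms

section Brackets

variable {C : Type u} [Category.{v} C] [Preadditive C] [MonoidalCategory C] [SymmetricCategory C]
variable (S : C)

/-- `Στ_{A,A} : ΣA ⊗ A ⟶ ΣA ⊗ A`, the exchange of the two copies of `A`, fixing `Σ`. -/
def swapOut (A : C) : (S ⊗ A) ⊗ A ⟶ (S ⊗ A) ⊗ A :=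
  (α_ S A A).hom ≫ S ◁ (β_ A A).hom ≫ (α_ S A A).inv

/-- Antisymmetry: `f = - Στ_{A,A} ∘ f ∘ τ_{ΣA,ΣA}`. -/
def IsAntisymmetric {A : C} (f : DoubleBracket S A) : Prop :=
  f = -((β_ (S ⊗ A) (S ⊗ A)).hom ≫ f ≫ swapOut S A)

/-- `τ_{X, X ⊗ X}`, that is `x ⊗ y ⊗ z ↦ y ⊗ z ⊗ x`. -/
def rotLeft (X : C) : X ⊗ (X ⊗ X) ⟶ X ⊗ (X ⊗ X) :=
  (β_ X (X ⊗ X)).hom ≫ (α_ X X X).hom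

/-- `τ_{X ⊗ X, X}`, that is `x ⊗ y ⊗ z ↦ z ⊗ x ⊗ y`. -/
def rotRight (X : C) : X ⊗ (X ⊗ X) ⟶ X ⊗ (X ⊗ X) :=
  (α_ X X X).inv ≫ (β_ (X ⊗ X) X).hom

/-- The morphism `(f ⊗ A) ∘ (ΣA ⊗ f) : ΣA ⊗ ΣA ⊗ ΣA ⟶ ΣA ⊗ A ⊗ A`,
with the target bracketed as `Σ ⊗ (A ⊗ (A ⊗ A))`. -/
def leftNested {A : C} (f : DoubleBracket S A) :
    (S ⊗ A) ⊗ ((S ⊗ A) ⊗ (S ⊗ A)) ⟶ S ⊗ (A ⊗ (A ⊗ A)) :=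
  (S ⊗ A) ◁ f ≫ (α_ (S ⊗ A) (S ⊗ A) A).inv ≫ f ▷ A ≫
    (α_ (S ⊗ A) A A).hom ≫ (α_ S A (A ⊗ A)).hom

/-- The double jacobiator of `f`, the sum of `leftNested f` over the cyclic permutations. -/
def doubleJacobiator {A : C} (f : DoubleBracket S A) :
    (S ⊗ A) ⊗ ((S ⊗ A) ⊗ (S ⊗ A)) ⟶ S ⊗ (A ⊗ (A ⊗ A)) :=
  leftNested S f +
    rotRight (S ⊗ A) ≫ leftNested S f ≫ S ◁ rotLeft A +
    rotLeft (S ⊗ A) ≫ leftNested S f ≫ S ◁ rotRight A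

/-- A `Σ`-double Lie bracket: antisymmetric, with vanishing double jacobiator. -/
structure IsDoubleLie {A : C} (f : DoubleBracket S A) : Prop where
  antisymm : IsAntisymmetric S f
  jacobi : doubleJacobiator S f = 0

lemma swapOut_naturality {A B : C} (φ : A ⟶ B) :
    (S ◁ φ ⊗ₘ φ) ≫ swapOut S B = swapOut S A ≫ (S ◁ φ ⊗ₘ φ) := by
  have h : (S ◁ φ ⊗ₘ φ) = (α_ S A A).hom ≫ S ◁ (φ ⊗ₘ φ) ≫ (α_ S B B).inv := by
    rw [← id_tensorHom, ← id_tensorHom, associator_inv_naturality]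
    simp
  have h' : S ◁ (φ ⊗ₘ φ) ≫ S ◁ (β_ B B).hom = S ◁ (β_ A A).hom ≫ S ◁ (φ ⊗ₘ φ) := by
    rw [← MonoidalCategory.whiskerLeft_comp, ← MonoidalCategory.whiskerLeft_comp,
      BraidedCategory.braiding_naturality]
  simp only [swapOut, h, Category.assoc, Iso.inv_hom_id_assoc]
  rw [reassoc_of% h']

lemma rotLeft_naturality {A B : C} (φ : A ⟶ B) :
    (φ ⊗ₘ (φ ⊗ₘ φ)) ≫ rotLeft B = rotLeft A ≫ (φ ⊗ₘ (φ ⊗ₘ φ)) := by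
  rw [rotLeft, BraidedCategory.braiding_naturality_assoc, associator_naturality, rotLeft,
    Category.assoc]

lemma rotRight_naturality {A B : C} (φ : A ⟶ B) :
    (φ ⊗ₘ (φ ⊗ₘ φ)) ≫ rotRight B = rotRight A ≫ (φ ⊗ₘ (φ ⊗ₘ φ)) := by
  rw [rotRight, associator_inv_naturality_assoc, BraidedCategory.braiding_naturality, rotRight,
    Category.assoc]

variable {S} in
lemma IsBracketHom.leftNested {A B : C} {f : DoubleBracket S A} {g : DoubleBracket S B}
    {φ : A ⟶ B} (h : IsBracketHom S f g φ) :
    (S ◁ φ ⊗ₘ (S ◁ φ ⊗ₘ S ◁ φ)) ≫ leftNested S g =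
      leftNested S f ≫ S ◁ (φ ⊗ₘ (φ ⊗ₘ φ)) := by
  unfold IsBracketHom at h
  have e : (α_ (S ⊗ A) A A).hom ≫ (α_ S A (A ⊗ A)).hom ≫ S ◁ (φ ⊗ₘ (φ ⊗ₘ φ)) =
      ((S ◁ φ ⊗ₘ φ) ⊗ₘ φ) ≫ (α_ (S ⊗ B) B B).hom ≫ (α_ S B (B ⊗ B)).hom := by
    rw [associator_naturality_assoc, ← id_tensorHom, ← id_tensorHom, associator_naturality]
  unfold DoubleBrackets.leftNested
  have e₁ : f ▷ A ≫ ((S ◁ φ ⊗ₘ φ) ⊗ₘ φ) = ((S ◁ φ ⊗ₘ S ◁ φ) ⊗ₘ φ) ≫ g ▷ B := by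
    rw [← tensorHom_id, ← tensorHom_id, tensorHom_comp_tensorHom, tensorHom_comp_tensorHom, ← h,
      Category.id_comp, Category.comp_id]
  have e₂ : (S ⊗ A) ◁ f ≫ (S ◁ φ ⊗ₘ (S ◁ φ ⊗ₘ φ)) =
      (S ◁ φ ⊗ₘ (S ◁ φ ⊗ₘ S ◁ φ)) ≫ (S ⊗ B) ◁ g := by
    rw [← id_tensorHom (S ⊗ A), ← id_tensorHom (S ⊗ B), tensorHom_comp_tensorHom,
      tensorHom_comp_tensorHom, ← h, Category.id_comp, Category.comp_id]
  simp only [Category.assoc]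
  rw [e, reassoc_of% e₁, ← associator_inv_naturality_assoc, reassoc_of% e₂]

variable {S} in
lemma IsBracketHom.doubleJacobiator {A B : C} {f : DoubleBracket S A} {g : DoubleBracket S B}
    {φ : A ⟶ B} (h : IsBracketHom S f g φ) :
    (S ◁ φ ⊗ₘ (S ◁ φ ⊗ₘ S ◁ φ)) ≫ doubleJacobiator S g =
      doubleJacobiator S f ≫ S ◁ (φ ⊗ₘ (φ ⊗ₘ φ)) := by
  simp only [DoubleBrackets.doubleJacobiator, Preadditive.comp_add, Preadditive.add_comp,
    Category.assoc]
  have e₁ : S ◁ (φ ⊗ₘ (φ ⊗ₘ φ)) ≫ S ◁ rotLeft B = S ◁ rotLeft A ≫ S ◁ (φ ⊗ₘ (φ ⊗ₘ φ)) := by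
    rw [← MonoidalCategory.whiskerLeft_comp, ← MonoidalCategory.whiskerLeft_comp,
      rotLeft_naturality]
  have e₂ : S ◁ (φ ⊗ₘ (φ ⊗ₘ φ)) ≫ S ◁ rotRight B =
      S ◁ rotRight A ≫ S ◁ (φ ⊗ₘ (φ ⊗ₘ φ)) := by
    rw [← MonoidalCategory.whiskerLeft_comp, ← MonoidalCategory.whiskerLeft_comp,
      rotRight_naturality]
  rw [reassoc_of% (@rotRight_naturality), reassoc_of% (@rotLeft_naturality), reassoc_of% h.leftNested,
    reassoc_of% h.leftNested, h.leftNested, e₁, e₂]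

variable {S} in
/-- A double bracket on a direct summand, compatible with the inclusion into a double Lie algebra,
is a double Lie bracket. -/
lemma IsDoubleLie.of_retract [MonoidalPreadditive C] {A B : C} {f : DoubleBracket S A} {g : DoubleBracket S B}
    {φ : A ⟶ B} {ψ : B ⟶ A} (hr : φ ≫ ψ = 𝟙 A) (h : IsBracketHom S f g φ)
    (hg : IsDoubleLie S g) : IsDoubleLie S f where
  antisymm := by
    have hm : (S ◁ φ ⊗ₘ φ) ≫ (S ◁ ψ ⊗ₘ ψ) = 𝟙 _ := by
      rw [tensorHom_comp_tensorHom, ← MonoidalCategory.whiskerLeft_comp, hr,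
        MonoidalCategory.whiskerLeft_id, id_tensorHom_id]
    have := SplitMono.mono ⟨_, hm⟩
    have ha := hg.antisymm
    unfold IsAntisymmetric at *
    unfold IsBracketHom at h
    rw [← cancel_mono (S ◁ φ ⊗ₘ φ), ← h, ha]
    simp only [Preadditive.comp_neg, Preadditive.neg_comp, Category.assoc]
    rw [BraidedCategory.braiding_naturality_assoc, ← swapOut_naturality, reassoc_of% h]
  jacobi := by
    have hm : S ◁ (φ ⊗ₘ (φ ⊗ₘ φ)) ≫ S ◁ (ψ ⊗ₘ (ψ ⊗ₘ ψ)) = 𝟙 _ := by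
      rw [← MonoidalCategory.whiskerLeft_comp, tensorHom_comp_tensorHom,
        tensorHom_comp_tensorHom, hr, id_tensorHom_id, id_tensorHom_id,
        MonoidalCategory.whiskerLeft_id]
    have := SplitMono.mono ⟨_, hm⟩
    rw [← cancel_mono (S ◁ (φ ⊗ₘ (φ ⊗ₘ φ))), ← h.doubleJacobiator, hg.jacobi]
    simp

/-- The internal left action `A ⊗ (ΣA ⊗ A) ⟶ ΣA ⊗ A`, `a ⊗ (Σx ⊗ y) ↦ Σx ⊗ ay`. -/
def innerLeft (A : C) [MonObj A] : A ⊗ ((S ⊗ A) ⊗ A) ⟶ (S ⊗ A) ⊗ A :=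
  (α_ A (S ⊗ A) A).inv ≫ (β_ A (S ⊗ A)).hom ▷ A ≫ (α_ (S ⊗ A) A A).hom ≫
    (S ⊗ A) ◁ MonObj.mul

/-- The internal right action `(ΣA ⊗ A) ⊗ A ⟶ ΣA ⊗ A`, `(Σx ⊗ y) ⊗ b ↦ Σxb ⊗ y`. -/
def innerRight (A : C) [MonObj A] : ((S ⊗ A) ⊗ A) ⊗ A ⟶ (S ⊗ A) ⊗ A :=
  (α_ (S ⊗ A) A A).hom ≫ (S ⊗ A) ◁ (β_ A A).hom ≫ (α_ (S ⊗ A) A A).inv ≫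
    (α_ S A A).hom ▷ A ≫ (S ◁ MonObj.mul) ▷ A

/-- The left derivation property: `f` is a derivation in its first variable for the internal
bimodule structure of `ΣA ⊗ A`. The first summand is
`Σ(a ⊗ b) ⊗ Σc ↦ a ⊗ (Σb ⊗ Σc) ↦ a · f(b, c)`, the second one is
`Σ(a ⊗ b) ⊗ Σc ↦ (Σa ⊗ Σc) ⊗ b ↦ f(a, c) · b`. -/
def IsLeftDerivation {A : C} [MonObj A] (f : DoubleBracket S A) : Prop :=
  (S ◁ (MonObj.mul : A ⊗ A ⟶ A)) ▷ (S ⊗ A) ≫ f =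
    ((α_ S A A).inv ≫ (β_ S A).hom ▷ A ≫ (α_ A S A).hom) ▷ (S ⊗ A) ≫
        (α_ A (S ⊗ A) (S ⊗ A)).hom ≫ A ◁ f ≫ innerLeft S A +
      (α_ S A A).inv ▷ (S ⊗ A) ≫ (α_ (S ⊗ A) A (S ⊗ A)).hom ≫
        (S ⊗ A) ◁ (β_ A (S ⊗ A)).hom ≫ (α_ (S ⊗ A) (S ⊗ A) A).inv ≫ f ▷ A ≫ innerRight S A

/-- A `Σ`-double Poisson bracket on a monoid: a `Σ`-double Lie bracket with the left derivation
property. -/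
structure IsDoublePoisson {A : C} [MonObj A] (f : DoubleBracket S A) : Prop
    extends IsDoubleLie S f where
  derivation : IsLeftDerivation S f

/-- `Σ`-double Lie algebras. -/
structure DLie where
  X : C
  bracket : DoubleBracket S X
  isDoubleLie : IsDoubleLie S bracket

variable {S} in
/-- Morphisms of `Σ`-double Lie algebras. -/
@[ext]
structure DLie.Hom (L H : DLie S) where
  hom : L.X ⟶ H.X
  isBracketHom : IsBracketHom S L.bracket H.bracket hom

/-- The category of `Σ`-double Lie algebras. -/
instance : Category (DLie S) where
  Hom := DLie.Hom
  id L := ⟨𝟙 L.X, IsBracketHom.id S _⟩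
  comp φ ψ := ⟨φ.hom ≫ ψ.hom, φ.isBracketHom.comp ψ.isBracketHom⟩

end Brackets

/-! ### The free associative monoid -/

section TensorAlgebra

variable {C : Type u} [Category.{v} C] [MonoidalCategory C]

/-- The tensor power `M^{⊗ n}`, with `M^{⊗ 0}` the unit object. -/
def tpow (M : C) : ℕ → C
  | 0 => 𝟙_ C
  | n + 1 => tpow M n ⊗ M

/-- `φ^{⊗ n}`. -/
def tpowMap {M N : C} (φ : M ⟶ N) : ∀ n : ℕ, tpow M n ⟶ tpow N n
  | 0 => 𝟙 (𝟙_ C)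
  | n + 1 => tpowMap φ n ⊗ₘ φ

lemma tpowMap_id (M : C) (n : ℕ) : tpowMap (𝟙 M) n = 𝟙 _ := by
  induction n with
  | zero => rfl
  | succ n ih =>
    change tpowMap (𝟙 M) n ⊗ₘ 𝟙 M = 𝟙 (tpow M n ⊗ M)
    rw [ih, id_tensorHom_id]

lemma tpowMap_comp {M N P : C} (φ : M ⟶ N) (ψ : N ⟶ P) (n : ℕ) :
    tpowMap (φ ≫ ψ) n = tpowMap φ n ≫ tpowMap ψ n := by
  induction n with
  | zero => exact (Category.id_comp (𝟙 (𝟙_ C))).symm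
  | succ n ih =>
    change tpowMap (φ ≫ ψ) n ⊗ₘ (φ ≫ ψ) = (tpowMap φ n ⊗ₘ φ) ≫ (tpowMap ψ n ⊗ₘ ψ)
    rw [ih, tensorHom_comp_tensorHom]

variable (C) in
/-- For every object `M`, the coproduct `⨁ₙ M^{⊗ n}` exists and is preserved by the functors
`X ⊗ -` (hence, in a symmetric monoidal category, by the functors `- ⊗ X`). This is what it takes
to form the free monoid on `M` as `⨁ₙ M^{⊗ n}`. -/
class HasTensorAlgebras : Prop where
  hasCoproduct (M : C) : HasCoproduct (tpow M)
  preserves (X M : C) : PreservesColimit (Discrete.functor (tpow M)) (tensorLeft X)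

attribute [instance] HasTensorAlgebras.hasCoproduct HasTensorAlgebras.preserves

variable [HasTensorAlgebras C]

/-- The underlying object `⨁ₙ M^{⊗ n}` of the free monoid on `M`. -/
noncomputable def T (M : C) : C := ∐ (tpow M)

/-- The inclusion of the `n`-th summand. -/
noncomputable def T.inj (M : C) (n : ℕ) : tpow M n ⟶ T M := Sigma.ι (tpow M) n

/-- The unit of `T(M)`, the inclusion of the summand `M^{⊗ 0} = 𝟙`. -/
noncomputable def T.unit (M : C) : 𝟙_ C ⟶ T M := T.inj M 0

/-- The inclusion of the summand `M^{⊗ (n + 1)} = M^{⊗ n} ⊗ M`. -/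
noncomputable def T.injSucc (M : C) (n : ℕ) : tpow M n ⊗ M ⟶ T M := T.inj M (n + 1)

/-- The inclusion of the summand `M^{⊗ 1} = 𝟙 ⊗ M`. -/
noncomputable def T.injOne (M : C) : 𝟙_ C ⊗ M ⟶ T M := T.inj M 1

/-- The inclusion of the generators. -/
noncomputable def T.gen (M : C) : M ⟶ T M := (λ_ M).inv ≫ T.injOne M

/-- The morphism of underlying objects `⨁ₙ φ^{⊗ n}`. -/
noncomputable def T.map {M N : C} (φ : M ⟶ N) : T M ⟶ T N :=
  Sigma.desc (f := tpow M) fun n => tpowMap φ n ≫ T.inj N n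

/-- A morphism out of `X ⊗ T(M) = ⨁ₙ X ⊗ M^{⊗ n}`, given by its components. -/
noncomputable def T.tensorDesc {X M Z : C} (a : ∀ n, X ⊗ tpow M n ⟶ Z) : X ⊗ T M ⟶ Z :=
  Cofan.IsColimit.desc (isColimitOfHasCoproductOfPreservesColimit (tensorLeft X) (tpow M)) a

lemma T.inj_tensorDesc {X M Z : C} (a : ∀ n, X ⊗ tpow M n ⟶ Z) (n : ℕ) :
    X ◁ T.inj M n ≫ T.tensorDesc a = a n :=
  Cofan.IsColimit.fac (isColimitOfHasCoproductOfPreservesColimit (tensorLeft X) (tpow M)) a n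

lemma T.tensor_hom_ext {X M Z : C} {a b : X ⊗ T M ⟶ Z}
    (h : ∀ n, X ◁ T.inj M n ≫ a = X ◁ T.inj M n ≫ b) : a = b :=
  Cofan.IsColimit.hom_ext
    (isColimitOfHasCoproductOfPreservesColimit (tensorLeft X) (tpow M)) _ _ h

lemma T.hom_ext {M Z : C} {a b : T M ⟶ Z} (h : ∀ n, T.inj M n ≫ a = T.inj M n ≫ b) : a = b :=
  Sigma.hom_ext _ _ h

lemma T.inj_map {M N : C} (φ : M ⟶ N) (n : ℕ) :
    T.inj M n ≫ T.map φ = tpowMap φ n ≫ T.inj N n :=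
  Sigma.ι_desc _ n

lemma T.unit_map {M N : C} (φ : M ⟶ N) : T.unit M ≫ T.map φ = T.unit N :=
  (T.inj_map φ 0).trans (Category.id_comp (T.unit N))

lemma T.injSucc_map {M N : C} (φ : M ⟶ N) (n : ℕ) :
    T.injSucc M n ≫ T.map φ = (tpowMap φ n ⊗ₘ φ) ≫ T.injSucc N n :=
  T.inj_map φ (n + 1)

lemma T.injOne_map {M N : C} (φ : M ⟶ N) :
    T.injOne M ≫ T.map φ = 𝟙_ C ◁ φ ≫ T.injOne N := by
  rw [← id_tensorHom]
  exact T.inj_map φ 1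

lemma T.map_id (M : C) : T.map (𝟙 M) = 𝟙 (T M) :=
  T.hom_ext fun n => by rw [T.inj_map, tpowMap_id]; simp

lemma T.map_comp {M N P : C} (φ : M ⟶ N) (ψ : N ⟶ P) :
    T.map (φ ≫ ψ) = T.map φ ≫ T.map ψ :=
  T.hom_ext fun n => by
    rw [T.inj_map, reassoc_of% (@T.inj_map), T.inj_map, tpowMap_comp, Category.assoc]

lemma T.gen_map {M N : C} (φ : M ⟶ N) : T.gen M ≫ T.map φ = φ ≫ T.gen N := by
  rw [T.gen, Category.assoc, T.injOne_map, T.gen, leftUnitor_inv_naturality_assoc]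

variable [BraidedCategory C]

lemma T.tensor_hom_ext_right {X Y M Z : C} {a b : X ⊗ (T M ⊗ Y) ⟶ Z}
    (h : ∀ n, X ◁ T.inj M n ▷ Y ≫ a = X ◁ T.inj M n ▷ Y ≫ b) : a = b := by
  rw [← cancel_epi ((α_ X Y (T M)).hom ≫ X ◁ (β_ Y (T M)).hom)]
  refine T.tensor_hom_ext fun n => ?_
  have key : (X ⊗ Y) ◁ T.inj M n ≫ (α_ X Y (T M)).hom ≫ X ◁ (β_ Y (T M)).hom =
      (α_ X Y (tpow M n)).hom ≫ X ◁ (β_ Y (tpow M n)).hom ≫ X ◁ T.inj M n ▷ Y := by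
    simp [← MonoidalCategory.whiskerLeft_comp]
  simp only [Category.assoc] at key ⊢
  rw [reassoc_of% key, reassoc_of% key, h]

/-- Multiplication by a generator on the right, `T(M) ⊗ M ⟶ T(M)`: it includes the summand
`M^{⊗ n} ⊗ M = M^{⊗ (n + 1)}` in `T(M)`. -/
noncomputable def T.append (M : C) : T M ⊗ M ⟶ T M :=
  (β_ (T M) M).hom ≫ T.tensorDesc fun n => (β_ (tpow M n) M).inv ≫ T.injSucc M n

/-- Multiplication on the right by a word of length `n`, `T(M) ⊗ M^{⊗ n} ⟶ T(M)`. -/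
noncomputable def T.concat (M : C) : ∀ n : ℕ, T M ⊗ tpow M n ⟶ T M
  | 0 => (ρ_ (T M)).hom
  | n + 1 => (α_ (T M) (tpow M n) M).inv ≫ T.concat M n ▷ M ≫ T.append M

/-- The concatenation product of `T(M)`. -/
noncomputable def T.mul (M : C) : T M ⊗ T M ⟶ T M := T.tensorDesc (T.concat M)

lemma T.inj_append (M : C) (n : ℕ) : T.inj M n ▷ M ≫ T.append M = T.injSucc M n := by
  simp [T.append, T.inj_tensorDesc]

lemma T.inj_mul (M : C) (n : ℕ) : T M ◁ T.inj M n ≫ T.mul M = T.concat M n :=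
  T.inj_tensorDesc _ n

lemma T.injSucc_mul (M : C) (n : ℕ) : T M ◁ T.injSucc M n ≫ T.mul M =
    (α_ (T M) (tpow M n) M).inv ≫ T.concat M n ▷ M ≫ T.append M :=
  T.inj_mul M (n + 1)

lemma T.unit_concat (M : C) (n : ℕ) :
    T.unit M ▷ tpow M n ≫ T.concat M n = (λ_ (tpow M n)).hom ≫ T.inj M n := by
  induction n with
  | zero =>
    change T.unit M ▷ 𝟙_ C ≫ (ρ_ (T M)).hom = (λ_ (𝟙_ C)).hom ≫ T.unit M
    rw [rightUnitor_naturality, unitors_equal]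
  | succ n ih =>
    change T.unit M ▷ (tpow M n ⊗ M) ≫ (α_ (T M) (tpow M n) M).inv ≫ T.concat M n ▷ M ≫
      T.append M = (λ_ (tpow M n ⊗ M)).hom ≫ T.injSucc M n
    rw [associator_inv_naturality_left_assoc, ← comp_whiskerRight_assoc, ih,
      comp_whiskerRight_assoc, T.inj_append, leftUnitor_tensor_hom, Category.assoc]

lemma T.mul_append (M : C) :
    T.mul M ▷ M ≫ T.append M = (α_ (T M) (T M) M).hom ≫ T M ◁ T.append M ≫ T.mul M := by
  rw [← Iso.inv_comp_eq]
  refine T.tensor_hom_ext_right fun n => ?_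
  rw [← MonoidalCategory.whiskerLeft_comp_assoc, T.inj_append, T.injSucc_mul,
    associator_inv_naturality_middle_assoc, ← comp_whiskerRight_assoc, T.inj_mul]

lemma T.mul_concat (M : C) (n : ℕ) : T.mul M ▷ tpow M n ≫ T.concat M n =
    (α_ (T M) (T M) (tpow M n)).hom ≫ T M ◁ T.concat M n ≫ T.mul M := by
  induction n with
  | zero =>
    change T.mul M ▷ 𝟙_ C ≫ (ρ_ (T M)).hom =
      (α_ (T M) (T M) (𝟙_ C)).hom ≫ T M ◁ (ρ_ (T M)).hom ≫ T.mul M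
    simp
  | succ n ih =>
    change T.mul M ▷ (tpow M n ⊗ M) ≫ (α_ (T M) (tpow M n) M).inv ≫ T.concat M n ▷ M ≫
      T.append M = (α_ (T M) (T M) (tpow M n ⊗ M)).hom ≫ T M ◁ ((α_ (T M) (tpow M n) M).inv ≫
        T.concat M n ▷ M ≫ T.append M) ≫ T.mul M
    rw [associator_inv_naturality_left_assoc, ← comp_whiskerRight_assoc, ih]
    simp [T.mul_append]

/-- The monoid structure of the free monoid `T(M)`. -/
noncomputable instance (M : C) : MonObj (T M) where
  one := T.unit M
  mul := T.mul M
  one_mul := T.tensor_hom_ext fun n => by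
    rw [whisker_exchange_assoc, T.inj_mul, T.unit_concat, leftUnitor_naturality]
  mul_one := T.inj_mul M 0
  mul_assoc := T.tensor_hom_ext fun n => by
    rw [whisker_exchange_assoc, T.inj_mul, T.mul_concat, associator_naturality_right_assoc,
      ← MonoidalCategory.whiskerLeft_comp_assoc, T.inj_mul]

lemma T.append_map {M N : C} (φ : M ⟶ N) :
    T.append M ≫ T.map φ = (T.map φ ⊗ₘ φ) ≫ T.append N := by
  rw [← cancel_epi (λ_ (T M ⊗ M)).hom]
  refine T.tensor_hom_ext_right fun n => ?_
  rw [leftUnitor_naturality_assoc, leftUnitor_naturality_assoc, reassoc_of% (@T.inj_append),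
    T.injSucc_map, ← tensorHom_id (T.inj M n), tensorHom_comp_tensorHom_assoc, T.inj_map,
    Category.id_comp, ← T.inj_append, ← tensorHom_id, tensorHom_comp_tensorHom_assoc,
    Category.comp_id]

lemma T.concat_map {M N : C} (φ : M ⟶ N) (n : ℕ) :
    T.concat M n ≫ T.map φ = (T.map φ ⊗ₘ tpowMap φ n) ≫ T.concat N n := by
  induction n with
  | zero =>
    change (ρ_ (T M)).hom ≫ T.map φ = (T.map φ ⊗ₘ 𝟙 (𝟙_ C)) ≫ (ρ_ (T N)).hom
    simp
  | succ n ih =>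
    change ((α_ (T M) (tpow M n) M).inv ≫ T.concat M n ▷ M ≫ T.append M) ≫ T.map φ =
      (T.map φ ⊗ₘ (tpowMap φ n ⊗ₘ φ)) ≫ (α_ (T N) (tpow N n) N).inv ≫ T.concat N n ▷ N ≫
        T.append N
    rw [Category.assoc, Category.assoc, T.append_map, associator_inv_naturality_assoc,
      ← tensorHom_id, ← tensorHom_id, tensorHom_comp_tensorHom_assoc, ih,
      tensorHom_comp_tensorHom_assoc, Category.id_comp, Category.comp_id]

instance {M N : C} (φ : M ⟶ N) : IsMonHom (T.map φ) where
  one_hom := T.unit_map φ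
  mul_hom := T.tensor_hom_ext fun n => by
    change T M ◁ T.inj M n ≫ T.mul M ≫ T.map φ =
      T M ◁ T.inj M n ≫ (T.map φ ⊗ₘ T.map φ) ≫ T.mul N
    rw [reassoc_of% (@T.inj_mul), T.concat_map, ← T.inj_mul, ← id_tensorHom, ← id_tensorHom,
      tensorHom_comp_tensorHom_assoc, tensorHom_comp_tensorHom_assoc, T.inj_map,
      Category.id_comp, Category.comp_id]

end TensorAlgebra

/-! ### Quadratic double Poisson brackets on free monoids -/

section Quadratic

variable {C : Type u} [Category.{v} C] [Preadditive C] [MonoidalCategory C]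
variable [SymmetricCategory C] [HasTensorAlgebras C]
variable (S : C)

/-- A double bracket on `T(M)` is quadratic if its restrictions to `Σ𝟙 ⊗ Σ𝟙` and `ΣM ⊗ Σ𝟙` are
trivial and its restriction to `ΣM ⊗ ΣM` takes values in `ΣM ⊗ M`. -/
structure IsQuadratic {M : C} (f : DoubleBracket S (T M)) : Prop where
  unit_unit : (S ◁ T.unit M ⊗ₘ S ◁ T.unit M) ≫ f = 0
  gen_unit : (S ◁ T.gen M ⊗ₘ S ◁ T.unit M) ≫ f = 0
  gen_gen : ∃ g : DoubleBracket S M,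
    (S ◁ T.gen M ⊗ₘ S ◁ T.gen M) ≫ f = g ≫ (S ◁ T.gen M ⊗ₘ T.gen M)

/-- Quadratic `Σ`-double Poisson brackets on the free monoid `T(M)`. -/
@[ext]
structure QuadBracket (M : C) where
  bracket : DoubleBracket S (T M)
  isDoublePoisson : IsDoublePoisson S bracket
  isQuadratic : IsQuadratic S bracket

/-- Free monoids with a quadratic `Σ`-double Poisson bracket. -/
structure DPFreeQuad where
  X : C
  str : QuadBracket S X

variable {S} in
/-- Morphisms of `Σ`-double Poisson algebras that are induced by a morphism between the objects of
generators. -/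
@[ext]
structure DPFreeQuad.Hom (P Q : DPFreeQuad S) where
  hom : T P.X ⟶ T Q.X
  isMonHom : IsMonHom hom
  isBracketHom : IsBracketHom S P.str.bracket Q.str.bracket hom
  induced : ∃ φ : P.X ⟶ Q.X, hom = T.map φ

/-- The category of free monoids with a quadratic `Σ`-double Poisson bracket. -/
noncomputable instance : Category (DPFreeQuad S) where
  Hom := DPFreeQuad.Hom
  id P := ⟨𝟙 _, inferInstance, IsBracketHom.id S _, 𝟙 _, (T.map_id _).symm⟩
  comp f g :=
    { hom := f.hom ≫ g.hom
      isMonHom := by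
        have := f.isMonHom
        have := g.isMonHom
        infer_instance
      isBracketHom := f.isBracketHom.comp g.isBracketHom
      induced := by
        obtain ⟨φ, hφ⟩ := f.induced
        obtain ⟨ψ, hψ⟩ := g.induced
        exact ⟨φ ≫ ψ, by rw [hφ, hψ, T.map_comp]⟩ }

/-- The functor `Σ-DLie ⥤ Σ-DPFree^quad` induced by `T(-)` once every double Lie bracket on `L` has
been extended to `T(L)`, in such a way that `T(φ)` commutes with the extended brackets for every
morphism `φ`. -/
noncomputable def freeFunctor (ext : ∀ L : DLie S, QuadBracket S L.X)
    (hext : ∀ {L H : DLie S} (φ : L ⟶ H),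
      IsBracketHom S (ext L).bracket (ext H).bracket (T.map φ.hom)) :
    DLie S ⥤ DPFreeQuad S where
  obj L := ⟨L.X, ext L⟩
  map φ := ⟨T.map φ.hom, inferInstance, hext φ, φ.hom, rfl⟩
  map_id L := DPFreeQuad.Hom.ext (T.map_id L.X)
  map_comp φ ψ := DPFreeQuad.Hom.ext (T.map_comp φ.hom ψ.hom)

/-- The components of the projection of `T(M)` onto its summand `M`. -/
def T.projComponent (M : C) : ∀ n : ℕ, tpow M n ⟶ M
  | 0 => 0
  | 1 => (λ_ M).hom
  | _ + 2 => 0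

/-- The projection of `T(M)` onto its summand `M`. -/
noncomputable def T.proj (M : C) : T M ⟶ M :=
  Sigma.desc (f := tpow M) (T.projComponent M)

lemma T.injOne_proj (M : C) : T.injOne M ≫ T.proj M = (λ_ M).hom :=
  Sigma.ι_desc (f := tpow M) (T.projComponent M) 1

lemma T.gen_proj (M : C) : T.gen M ≫ T.proj M = 𝟙 M := by
  rw [T.gen, Category.assoc, T.injOne_proj, Iso.inv_hom_id]

variable {S}

/-- The restriction of a quadratic double Poisson bracket on `T(M)` to `ΣM ⊗ ΣM`, as a morphism
`ΣM ⊗ ΣM ⟶ ΣM ⊗ M`. -/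
noncomputable def QuadBracket.restrict {M : C} (q : QuadBracket S M) : DoubleBracket S M :=
  (S ◁ T.gen M ⊗ₘ S ◁ T.gen M) ≫ q.bracket ≫ (S ◁ T.proj M ⊗ₘ T.proj M)

lemma QuadBracket.restrict_spec {M : C} (q : QuadBracket S M) :
    IsBracketHom S q.restrict q.bracket (T.gen M) := by
  obtain ⟨g, hg⟩ := q.isQuadratic.gen_gen
  have h : q.restrict = g := by
    unfold QuadBracket.restrict
    rw [reassoc_of% hg, tensorHom_comp_tensorHom, ← MonoidalCategory.whiskerLeft_comp,
      T.gen_proj, MonoidalCategory.whiskerLeft_id, id_tensorHom_id, Category.comp_id]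
  rw [h]
  exact hg

lemma DPFreeQuad.Hom.gen_hom {P Q : DPFreeQuad S} (h : P ⟶ Q) :
    T.gen P.X ≫ h.hom = (T.gen P.X ≫ h.hom ≫ T.proj Q.X) ≫ T.gen Q.X := by
  obtain ⟨φ, hφ⟩ := h.induced
  rw [hφ, reassoc_of% (@T.gen_map), T.gen_proj, Category.comp_id, T.gen_map]

variable (S) in
/-- The functor that restricts the brackets and the morphisms to the generators. -/
noncomputable def restrictFunctor [MonoidalPreadditive C] : DPFreeQuad S ⥤ DLie S where
  obj P := ⟨P.X, P.str.restrict,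
    IsDoubleLie.of_retract (T.gen_proj P.X) P.str.restrict_spec P.str.isDoublePoisson.toIsDoubleLie⟩
  map {P Q} h := ⟨T.gen P.X ≫ h.hom ≫ T.proj Q.X, by
    have hm : (S ◁ T.gen Q.X ⊗ₘ T.gen Q.X) ≫ (S ◁ T.proj Q.X ⊗ₘ T.proj Q.X) = 𝟙 _ := by
      rw [tensorHom_comp_tensorHom, ← MonoidalCategory.whiskerLeft_comp, T.gen_proj,
        MonoidalCategory.whiskerLeft_id, id_tensorHom_id]
    have := SplitMono.mono ⟨_, hm⟩
    have h1 := P.str.restrict_spec.comp h.isBracketHom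
    have h2 := Q.str.restrict_spec
    rw [DPFreeQuad.Hom.gen_hom] at h1
    unfold IsBracketHom at *
    rw [← cancel_mono (S ◁ T.gen Q.X ⊗ₘ T.gen Q.X), Category.assoc, ← h2, Category.assoc,
      tensorHom_comp_tensorHom, ← MonoidalCategory.whiskerLeft_comp, ← h1,
      tensorHom_comp_tensorHom_assoc, ← MonoidalCategory.whiskerLeft_comp]⟩
  map_id P := DLie.Hom.ext (by
    change T.gen P.X ≫ 𝟙 _ ≫ T.proj P.X = 𝟙 P.X
    rw [Category.id_comp, T.gen_proj])
  map_comp {P Q R} f g := DLie.Hom.ext (by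
    change T.gen P.X ≫ (f.hom ≫ g.hom) ≫ T.proj R.X =
      (T.gen P.X ≫ f.hom ≫ T.proj Q.X) ≫ (T.gen Q.X ≫ g.hom ≫ T.proj R.X)
    rw [Category.assoc, reassoc_of% (DPFreeQuad.Hom.gen_hom f)]
    simp only [Category.assoc])

end Quadratic

end DoubleBrackets

open DoubleBrackets

namespace DoubleBrackets

open scoped ComonObj MonObj

set_option linter.unusedSectionVars false

/-! ### Elements at a cocommutative comonoid

A morphism `G ⟶ X` out of a cocommutative comonoid `G` is treated as an element of `X`. Elements
can be tensored, and equalities of morphisms can be tested on pure tensors. -/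

section Elements

variable {C : Type u} [Category.{v} C] [MonoidalCategory C]

/-! A bracket with the left derivation property is, with its second argument fixed, a derivation for
the inner bimodule structure. Antisymmetry then makes it a derivation in the second argument for the
outer structure, because exchanging the two output factors interchanges the inner and outer actions.
A derivation on `T(M)`, possibly depending on a parameter, exists and is unique for prescribed
values on `M` (`T.isDerivation_derivation`, `IsDerivation.eq_zero`), so a biderivation is determined
on pairs of generators (`biderivation_eq_zero`). This gives uniqueness of the extension and
compatibility of `T(φ)`.

For existence, extend `f` first in the second variable and then in the first. Only the left property
holds by construction. The failure of the right property is itself a derivation in the first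
variable, since inner and outer actions commute, and it vanishes on generators
(`isRightDerivation_extend`). Antisymmetry follows by comparing two biderivations.

For the Jacobi identity, the double jacobiator is a derivation in its last variable with values in
`Σ(A ⊗ A ⊗ A)`. Expanding it leaves two cross terms, each a product of two brackets in the middle
factor. Since `Σ ⊗ -` is full, every bracket has the form `f(sa, tb) = t g₀(s, a, b)`, with the
second `Σ` merely carried along (`exists_isLift`). In this form antisymmetry makes the cross terms
opposite. The jacobiator is also invariant under cyclic permutations, so its vanishing on generators
spreads to one variable after another.

Restriction to generators inverts the extension: on objects by uniqueness, on morphisms because they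
are of the form `T(φ)`.

All diagrams are checked on elements. An element of `X` is a morphism `G ⟶ X` from a cocommutative
comonoid; the comultiplication makes tensors of elements behave like tensors of vectors, with the
symmetry acting by plain exchange. Pure tensors suffice because every object is a retract of a
cocommutative comonoid, namely `𝟙 ⊞ X` with `X` primitive. -/

/-- The tensor product of two elements at the stage `G`. -/
def tens {G X Y : C} [ComonObj G] (x : G ⟶ X) (y : G ⟶ Y) : G ⟶ X ⊗ Y := Δ[G] ≫ (x ⊗ₘ y)

scoped infixr:70 " ⊠ " => tens

variable {G : C} [ComonObj G]

lemma tens_tensorHom {X Y X' Y' : C} (x : G ⟶ X) (y : G ⟶ Y) (f : X ⟶ X') (g : Y ⟶ Y') :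
    (x ⊠ y) ≫ (f ⊗ₘ g) = (x ≫ f) ⊠ (y ≫ g) := by
  simp [tens]

lemma tens_whiskerLeft {X Y Y' : C} (x : G ⟶ X) (y : G ⟶ Y) (g : Y ⟶ Y') :
    (x ⊠ y) ≫ X ◁ g = x ⊠ (y ≫ g) := by
  rw [← id_tensorHom, tens_tensorHom, Category.comp_id]

lemma tens_whiskerRight {X Y X' : C} (x : G ⟶ X) (y : G ⟶ Y) (f : X ⟶ X') :
    (x ⊠ y) ≫ f ▷ Y = (x ≫ f) ⊠ y := by
  rw [← tensorHom_id, tens_tensorHom, Category.comp_id]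

/-- Coassociativity of `G`. -/
lemma tens_associator_hom {X Y Z : C} (x : G ⟶ X) (y : G ⟶ Y) (z : G ⟶ Z) :
    ((x ⊠ y) ⊠ z) ≫ (α_ X Y Z).hom = x ⊠ (y ⊠ z) := by
  have h₁ : (x ⊠ y) ⊠ z = Δ[G] ≫ Δ[G] ▷ G ≫ ((x ⊗ₘ y) ⊗ₘ z) := by
    rw [tens, tens, ← tensorHom_id, tensorHom_comp_tensorHom, Category.id_comp]
  have h₂ : x ⊠ (y ⊠ z) = Δ[G] ≫ G ◁ Δ[G] ≫ (x ⊗ₘ (y ⊗ₘ z)) := by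
    rw [tens, tens, ← id_tensorHom, tensorHom_comp_tensorHom, Category.id_comp]
  rw [h₁, h₂]
  simp

lemma tens_associator_inv {X Y Z : C} (x : G ⟶ X) (y : G ⟶ Y) (z : G ⟶ Z) :
    (x ⊠ (y ⊠ z)) ≫ (α_ X Y Z).inv = (x ⊠ y) ⊠ z := by
  rw [Iso.comp_inv_eq, tens_associator_hom]

lemma comp_leftUnitor_inv {X : C} (x : G ⟶ X) : x ≫ (λ_ X).inv = ε[G] ⊠ x := by
  simp [tens]

lemma comp_rightUnitor_inv {X : C} (x : G ⟶ X) : x ≫ (ρ_ X).inv = x ⊠ ε[G] := by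
  simp [tens]

lemma tens_leftUnitor_hom {X : C} (x : G ⟶ X) : (ε[G] ⊠ x) ≫ (λ_ X).hom = x := by
  rw [← comp_leftUnitor_inv, Category.assoc, Iso.inv_hom_id, Category.comp_id]

lemma tens_rightUnitor_hom {X : C} (x : G ⟶ X) : (x ⊠ ε[G]) ≫ (ρ_ X).hom = x := by
  rw [← comp_rightUnitor_inv, Category.assoc, Iso.inv_hom_id, Category.comp_id]

lemma comp_tens {G H X Y : C} [ComonObj G] [ComonObj H] (φ : H ⟶ G) [IsComonHom φ]
    (x : G ⟶ X) (y : G ⟶ Y) : φ ≫ (x ⊠ y) = (φ ≫ x) ⊠ (φ ≫ y) := by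
  simp [tens]

section Preadditive

variable [Preadditive C] [MonoidalPreadditive C]

lemma tens_add {X Y : C} (x : G ⟶ X) (y y' : G ⟶ Y) : x ⊠ (y + y') = x ⊠ y + x ⊠ y' := by
  simp [tens, MonoidalPreadditive.tensor_add]

lemma add_tens {X Y : C} (x x' : G ⟶ X) (y : G ⟶ Y) : (x + x') ⊠ y = x ⊠ y + x' ⊠ y := by
  simp [tens, MonoidalPreadditive.add_tensor]

lemma tens_zero {X Y : C} (x : G ⟶ X) : x ⊠ (0 : G ⟶ Y) = 0 := by
  simp [tens, MonoidalPreadditive.tensor_zero]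

lemma zero_tens {X Y : C} (y : G ⟶ Y) : (0 : G ⟶ X) ⊠ y = 0 := by
  simp [tens, MonoidalPreadditive.zero_tensor]

lemma tens_neg {X Y : C} (x : G ⟶ X) (y : G ⟶ Y) : x ⊠ (-y) = -(x ⊠ y) := by
  rw [eq_neg_iff_add_eq_zero, ← tens_add, neg_add_cancel, tens_zero]

lemma neg_tens {X Y : C} (x : G ⟶ X) (y : G ⟶ Y) : (-x) ⊠ y = -(x ⊠ y) := by
  rw [eq_neg_iff_add_eq_zero, ← add_tens, neg_add_cancel, zero_tens]

lemma tens_sub {X Y : C} (x : G ⟶ X) (y y' : G ⟶ Y) : x ⊠ (y - y') = x ⊠ y - x ⊠ y' := by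
  rw [sub_eq_add_neg, tens_add, tens_neg, ← sub_eq_add_neg]

lemma sub_tens {X Y : C} (x x' : G ⟶ X) (y : G ⟶ Y) : (x - x') ⊠ y = x ⊠ y - x' ⊠ y := by
  rw [sub_eq_add_neg, add_tens, neg_tens, ← sub_eq_add_neg]

end Preadditive

section Braided

/-- This is where cocommutativity enters: the symmetry of the category, with any signs it hides,
becomes a plain exchange of elements. -/
lemma tens_braiding_hom [BraidedCategory C] [IsCommComonObj G] {X Y : C} (x : G ⟶ X) (y : G ⟶ Y) :
    (x ⊠ y) ≫ (β_ X Y).hom = y ⊠ x := by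
  simp [tens]

instance [SymmetricCategory C] (G H : C) [ComonObj G] [ComonObj H] [IsCommComonObj G]
    [IsCommComonObj H] : IsCommComonObj (G ⊗ H) where
  comul_comm := by
    rw [Comon.tensorObj_comul, Category.assoc, SymmetricCategory.tensorμ_braid_swap,
      tensorHom_comp_tensorHom_assoc, IsCommComonObj.comul_comm, IsCommComonObj.comul_comm]

variable [BraidedCategory C]

/-- The projection of a tensor product of comonoids onto the first factor. -/
def stageFst (G H : C) [ComonObj H] : G ⊗ H ⟶ G := G ◁ ε[H] ≫ (ρ_ G).hom

/-- The projection of a tensor product of comonoids onto the second factor. -/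
def stageSnd (G H : C) [ComonObj G] : G ⊗ H ⟶ H := ε[G] ▷ H ≫ (λ_ H).hom

instance (G H : C) [ComonObj G] [ComonObj H] : IsComonHom (stageFst G H) where
  hom_counit := by
    rw [stageFst, Comon.tensorObj_counit, MonoidalCategory.tensorHom_def', Category.assoc,
      Category.assoc, ← rightUnitor_naturality, unitors_equal]
  hom_comul := by
    have h : (Δ[G] ⊗ₘ Δ[H]) ≫ ((G ⊗ G) ◁ (ε[H] ⊗ₘ ε[H])) =
        G ◁ ε[H] ≫ Δ[G] ▷ 𝟙_ C ≫ (G ⊗ G) ◁ (λ_ (𝟙_ C)).inv := by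
      rw [MonoidalCategory.tensorHom_def', Category.assoc, ← whisker_exchange,
        ← MonoidalCategory.whiskerLeft_comp_assoc, ComonObj.counit_comul_hom,
        MonoidalCategory.whiskerLeft_comp_assoc, whisker_exchange]
    have h' : stageFst G H ⊗ₘ stageFst G H =
        ((𝟙 G ⊗ₘ ε[H]) ⊗ₘ (𝟙 G ⊗ₘ ε[H])) ≫ ((ρ_ G).hom ⊗ₘ (ρ_ G).hom) := by
      simp [stageFst]
    rw [h', Comon.tensorObj_comul, Category.assoc, ← tensorμ_natural_assoc, id_tensorHom_id,
      id_tensorHom, reassoc_of% h, ← tensor_right_unitality, stageFst]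
    simp

instance (G H : C) [ComonObj G] [ComonObj H] : IsComonHom (stageSnd G H) where
  hom_counit := by
    rw [stageSnd, Comon.tensorObj_counit, MonoidalCategory.tensorHom_def, Category.assoc,
      Category.assoc, ← leftUnitor_naturality]
  hom_comul := by
    have h : (Δ[G] ⊗ₘ Δ[H]) ≫ ((ε[G] ⊗ₘ ε[G]) ▷ (H ⊗ H)) =
        ε[G] ▷ H ≫ 𝟙_ C ◁ Δ[H] ≫ (λ_ (𝟙_ C)).inv ▷ (H ⊗ H) := by
      rw [MonoidalCategory.tensorHom_def, Category.assoc, whisker_exchange,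
        ← comp_whiskerRight_assoc, ComonObj.counit_comul_hom,
        comp_whiskerRight_assoc, ← whisker_exchange]
    have h' : stageSnd G H ⊗ₘ stageSnd G H =
        ((ε[G] ⊗ₘ 𝟙 H) ⊗ₘ (ε[G] ⊗ₘ 𝟙 H)) ≫ ((λ_ H).hom ⊗ₘ (λ_ H).hom) := by
      simp [stageSnd]
    rw [h', Comon.tensorObj_comul, Category.assoc, ← tensorμ_natural_assoc, id_tensorHom_id,
      tensorHom_id, reassoc_of% h, ← tensor_left_unitality, stageSnd]
    simp

/-- By the counit laws, the diagonal of `G ⊗ H` followed by the two projections is the identity, as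
in a cartesian category. -/
lemma stageFst_tens_stageSnd (G H : C) [ComonObj G] [ComonObj H] :
    stageFst G H ⊠ stageSnd G H = 𝟙 (G ⊗ H) := by
  have h : stageFst G H ⊗ₘ stageSnd G H =
      ((𝟙 G ⊗ₘ ε[H]) ⊗ₘ (ε[G] ⊗ₘ 𝟙 H)) ≫ ((ρ_ G).hom ⊗ₘ (λ_ H).hom) := by
    simp [stageFst, stageSnd]
  rw [tens, h, Comon.tensorObj_comul, Category.assoc, ← tensorμ_natural_assoc,
    tensorHom_comp_tensorHom_assoc, id_tensorHom, tensorHom_id,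
    ComonObj.comul_counit, ComonObj.counit_comul, tensorμ, braiding_tensorUnit_left]
  monoidal

end Braided

end Elements

/-! ### Every object is a retract of a cocommutative comonoid. -/

section SquareZero

variable {C : Type u} [Category.{v} C] [Preadditive C] [HasBinaryBiproducts C]
  [MonoidalCategory C] [MonoidalPreadditive C]

/-- The comultiplication of `𝟙 ⊞ X` for which `X` is primitive. -/
noncomputable def primComul (X : C) : 𝟙_ C ⊞ X ⟶ (𝟙_ C ⊞ X) ⊗ (𝟙_ C ⊞ X) :=
  biprod.desc ((λ_ (𝟙_ C)).inv ≫ (biprod.inl ⊗ₘ biprod.inl))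
    ((λ_ X).inv ≫ (biprod.inl ⊗ₘ biprod.inr) + (ρ_ X).inv ≫ (biprod.inr ⊗ₘ biprod.inl))

/-- The comonoid `𝟙 ⊞ X` for which `X` is primitive. -/
noncomputable abbrev primComon (X : C) : ComonObj (𝟙_ C ⊞ X) where
  counit := biprod.fst
  comul := primComul X
  counit_comul := by
    ext <;> simp [primComul, ← tensorHom_id, MonoidalPreadditive.zero_tensor]
  comul_counit := by
    ext <;> simp [primComul, ← id_tensorHom, MonoidalPreadditive.tensor_zero, unitors_inv_equal]
  comul_assoc := by
    ext
    · simp only [primComul, ← tensorHom_id, ← id_tensorHom, biprod.inl_desc_assoc, Category.assoc,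
        tensorHom_comp_tensorHom, tensorHom_comp_tensorHom_assoc, Category.comp_id,
        biprod.inl_desc]
      monoidal
    · simp only [primComul, ← tensorHom_id, ← id_tensorHom, Category.assoc,
        tensorHom_comp_tensorHom, tensorHom_comp_tensorHom_assoc, Category.comp_id, biprod.inl_desc, biprod.inr_desc_assoc,
        biprod.inr_desc, Preadditive.add_comp, Preadditive.comp_add,
        MonoidalPreadditive.tensor_add, MonoidalPreadditive.add_tensor]
      rw [← add_assoc]
      congr 1
      · congr 1 <;> monoidal
      · monoidal

lemma primComon_comm [BraidedCategory C] (X : C) :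
    letI := primComon X
    IsCommComonObj (𝟙_ C ⊞ X) :=
  letI := primComon X
  { comul_comm := by
      ext
      · simp [ComonObj.comul, primComul, BraidedCategory.braiding_naturality, unitors_inv_equal]
      · simp [ComonObj.comul, primComul, BraidedCategory.braiding_naturality, add_comm] }

end SquareZero

/-! ### Testing equalities on classes of elements. -/

section Detecting

variable {C : Type u} [Category.{v} C] [MonoidalCategory C] [BraidedCategory C]

/-- A class of elements of `X` that is stable under change of stage and contains a split
epimorphism. -/
structure Detecting {X : C}
    (P : ∀ (G : C) [ComonObj G] [IsCommComonObj G], (G ⟶ X) → Prop) : Prop where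
  exists_splitEpi : ∃ (G : C) (_ : ComonObj G) (_ : IsCommComonObj G) (x : G ⟶ X),
    P G x ∧ IsSplitEpi x
  comp : ∀ {G H : C} [ComonObj G] [IsCommComonObj G] [ComonObj H] [IsCommComonObj H]
    (φ : H ⟶ G) [IsComonHom φ] {x : G ⟶ X}, P G x → P H (φ ≫ x)

lemma Detecting.hom_ext {X Z : C} {P : ∀ (G : C) [ComonObj G] [IsCommComonObj G], (G ⟶ X) → Prop}
    (hP : Detecting P) {f g : X ⟶ Z}
    (h : ∀ (G : C) [ComonObj G] [IsCommComonObj G] (x : G ⟶ X), P G x → x ≫ f = x ≫ g) : f = g := by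
  obtain ⟨G, _, _, x, hx, _⟩ := hP.exists_splitEpi
  exact (cancel_epi x).1 (h G x hx)

lemma Detecting.all [Preadditive C] [HasBinaryBiproducts C] [MonoidalPreadditive C] (X : C) :
    Detecting (X := X) fun _ _ _ _ => True where
  exists_splitEpi :=
    letI := primComon X
    ⟨𝟙_ C ⊞ X, primComon X, primComon_comm X, biprod.snd, trivial, inferInstance⟩
  comp _ _ _ _ := trivial

-- The unit object is already a cocommutative comonoid, so its only relevant element is the counit.
-- In an empty word the unit of a monoid can thus be written `ε ≫ η`.
attribute [local instance] ComonObj.instTensorUnit in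
lemma Detecting.unit : Detecting (X := 𝟙_ C) fun G _ _ x => x = ε[G] where
  exists_splitEpi := ⟨𝟙_ C, inferInstance, inferInstance, 𝟙 _, rfl, inferInstance⟩
  comp φ _ _ h := by rw [h, IsComonHom.hom_counit]

end Detecting

section Symmetric

variable {C : Type u} [Category.{v} C] [MonoidalCategory C] [SymmetricCategory C]

/-- Pure tensors detect equalities. -/
lemma Detecting.tens {X Y : C}
    {P : ∀ (G : C) [ComonObj G] [IsCommComonObj G], (G ⟶ X) → Prop}
    {Q : ∀ (G : C) [ComonObj G] [IsCommComonObj G], (G ⟶ Y) → Prop}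
    (hP : Detecting P) (hQ : Detecting Q) :
    Detecting (X := X ⊗ Y) fun G _ _ z => ∃ x y, P G x ∧ Q G y ∧ z = x ⊠ y where
  exists_splitEpi := by
    obtain ⟨G, _, _, x, hx, _⟩ := hP.exists_splitEpi
    obtain ⟨H, _, _, y, hy, _⟩ := hQ.exists_splitEpi
    -- Pulled back to `G ⊗ H` along the two projections, `x` and `y` become elements at a common
    -- stage, and their tensor is `x ⊗ₘ y`. This is why detecting classes must be stable under
    -- change of stage.
    refine ⟨G ⊗ H, inferInstance, inferInstance, x ⊗ₘ y, ⟨stageFst G H ≫ x, stageSnd G H ≫ y,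
      hP.comp _ hx, hQ.comp _ hy, ?_⟩, ⟨⟨⟨section_ x ⊗ₘ section_ y, by simp⟩⟩⟩⟩
    rw [← tens_tensorHom, stageFst_tens_stageSnd, Category.id_comp]
  comp := by
    rintro G H _ _ _ _ φ _ _ ⟨x, y, hx, hy, rfl⟩
    exact ⟨φ ≫ x, φ ≫ y, hP.comp φ hx, hQ.comp φ hy, comp_tens φ x y⟩

end Symmetric

/-! ### Derivations out of a free monoid, with parameters -/

section Derivations

variable {C : Type u} [Category.{v} C] [MonoidalCategory C]

section Mul

variable {A G : C} [MonObj A] [ComonObj G]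

lemma tens_mul_assoc (a b c : G ⟶ A) :
    ((a ⊠ b) ≫ μ[A] ⊠ c) ≫ μ[A] = (a ⊠ (b ⊠ c) ≫ μ[A]) ≫ μ[A] := by
  rw [← tens_whiskerRight, Category.assoc, MonObj.mul_assoc, ← tens_whiskerLeft,
    ← tens_associator_hom]
  simp only [Category.assoc]

lemma tens_one_mul (a : G ⟶ A) : (ε[G] ≫ η[A] ⊠ a) ≫ μ[A] = a := by
  rw [← tens_whiskerRight, Category.assoc, MonObj.one_mul, tens_leftUnitor_hom]

lemma tens_mul_one (a : G ⟶ A) : (a ⊠ ε[G] ≫ η[A]) ≫ μ[A] = a := by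
  rw [← tens_whiskerLeft, Category.assoc, MonObj.mul_one, tens_rightUnitor_hom]

end Mul

variable [BraidedCategory C] {A N : C} [MonObj A]

/-- The unit of `A` acts as the identity through `l` and through `r`. -/
structure IsUnitalPair (l : A ⊗ N ⟶ N) (r : N ⊗ A ⟶ N) : Prop where
  one_act : ∀ {G : C} [ComonObj G] [IsCommComonObj G] (n : G ⟶ N), (ε[G] ≫ η[A] ⊠ n) ≫ l = n
  act_one : ∀ {G : C} [ComonObj G] [IsCommComonObj G] (n : G ⟶ N), (n ⊠ ε[G] ≫ η[A]) ≫ r = n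

/-- `l` and `r` are the actions of a bimodule. -/
structure IsBimodule (l : A ⊗ N ⟶ N) (r : N ⊗ A ⟶ N) : Prop extends IsUnitalPair l r where
  mul_act : ∀ {G : C} [ComonObj G] [IsCommComonObj G] (a b : G ⟶ A) (n : G ⟶ N),
    ((a ⊠ b) ≫ μ[A] ⊠ n) ≫ l = (a ⊠ (b ⊠ n) ≫ l) ≫ l
  act_mul : ∀ {G : C} [ComonObj G] [IsCommComonObj G] (a b : G ⟶ A) (n : G ⟶ N),
    (n ⊠ (a ⊠ b) ≫ μ[A]) ≫ r = ((n ⊠ a) ≫ r ⊠ b) ≫ r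
  act_comm : ∀ {G : C} [ComonObj G] [IsCommComonObj G] (a b : G ⟶ A) (n : G ⟶ N),
    ((a ⊠ n) ≫ l ⊠ b) ≫ r = (a ⊠ (n ⊠ b) ≫ r) ≫ l

variable [Preadditive C]

/-- `D(q, ab) = a D(q, b) + D(q, a) b`. -/
def IsDerivation {Q : C} (l : A ⊗ N ⟶ N) (r : N ⊗ A ⟶ N) (D : Q ⊗ A ⟶ N) : Prop :=
  ∀ (G : C) [ComonObj G] [IsCommComonObj G] (q : G ⟶ Q) (a b : G ⟶ A),
    (q ⊠ (a ⊠ b) ≫ μ[A]) ≫ D = (a ⊠ (q ⊠ b) ≫ D) ≫ l + ((q ⊠ a) ≫ D ⊠ b) ≫ r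

/-- Evaluating the diagram on `q ⊠ a ⊠ b` gives the Leibniz rule at every stage at once. -/
lemma IsDerivation.of_comp_eq {Q : C} {l : A ⊗ N ⟶ N} {r : N ⊗ A ⟶ N} {D : Q ⊗ A ⟶ N}
    (h : Q ◁ μ[A] ≫ D = (α_ Q A A).inv ≫
      ((β_ Q A).hom ▷ A ≫ (α_ A Q A).hom ≫ A ◁ D ≫ l + D ▷ A ≫ r)) : IsDerivation l r D := by
  intro G _ _ q a b
  have := whisker_eq (q ⊠ a ⊠ b) h
  simpa only [Preadditive.comp_add, ← Category.assoc, tens_whiskerLeft, tens_whiskerRight,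
    tens_associator_hom, tens_associator_inv, tens_braiding_hom] using this

/-- Since `1 = 1 · 1`, the value `D(q, 1)` equals its own double. Only the unit laws of the actions
are involved. -/
lemma IsDerivation.one {Q : C} {l : A ⊗ N ⟶ N} {r : N ⊗ A ⟶ N} {D : Q ⊗ A ⟶ N}
    (hD : IsDerivation l r D) (h : IsUnitalPair l r) {G : C} [ComonObj G] [IsCommComonObj G]
    (q : G ⟶ Q) : (q ⊠ ε[G] ≫ η[A]) ≫ D = 0 := by
  have := hD G q (ε[G] ≫ η[A]) (ε[G] ≫ η[A])
  rw [tens_one_mul, h.one_act, h.act_one] at this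
  simpa using this

section Operations

variable {Q Q' N' : C} {l : A ⊗ N ⟶ N} {r : N ⊗ A ⟶ N} {D D' : Q ⊗ A ⟶ N}

lemma IsDerivation.whiskerRight_comp (hD : IsDerivation l r D) (g : Q' ⟶ Q) :
    IsDerivation l r (g ▷ A ≫ D) := by
  intro G _ _ q a b
  simp only [← Category.assoc, tens_whiskerRight]
  exact hD G (q ≫ g) a b

lemma IsDerivation.comp (hD : IsDerivation l r D) {l' : A ⊗ N' ⟶ N'} {r' : N' ⊗ A ⟶ N'}
    {ψ : N ⟶ N'} (hl : l ≫ ψ = A ◁ ψ ≫ l') (hr : r ≫ ψ = ψ ▷ A ≫ r') :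
    IsDerivation l' r' (D ≫ ψ) := by
  intro G _ _ q a b
  rw [← Category.assoc, hD, Preadditive.add_comp, Category.assoc, hl, Category.assoc, hr]
  simp only [← Category.assoc, tens_whiskerLeft, tens_whiskerRight]

variable [MonoidalPreadditive C]

lemma IsDerivation.add (hD : IsDerivation l r D) (hD' : IsDerivation l r D') :
    IsDerivation l r (D + D') := by
  intro G _ _ q a b
  simp only [Preadditive.comp_add, hD G q a b, hD' G q a b, tens_add, add_tens,
    Preadditive.add_comp]
  abel

lemma IsDerivation.neg (hD : IsDerivation l r D) : IsDerivation l r (-D) := by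
  intro G _ _ q a b
  simp only [Preadditive.comp_neg, hD G q a b, tens_neg, neg_tens, Preadditive.neg_comp]
  abel

lemma IsDerivation.sub (hD : IsDerivation l r D) (hD' : IsDerivation l r D') :
    IsDerivation l r (D - D') := by
  rw [sub_eq_add_neg]
  exact hD.add hD'.neg

end Operations

end Derivations

section Detecting

variable {C : Type u} [Category.{v} C] [MonoidalCategory C] [SymmetricCategory C]
  [Preadditive C] [MonoidalPreadditive C] [HasBinaryBiproducts C]

/-- The Leibniz rule can be tested on a detecting class of parameters. -/
lemma IsDerivation.of_detecting {A N Q : C} [MonObj A] {l : A ⊗ N ⟶ N}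
    {r : N ⊗ A ⟶ N} {D : Q ⊗ A ⟶ N}
    {P : ∀ (G : C) [ComonObj G] [IsCommComonObj G], (G ⟶ Q) → Prop} (hP : Detecting P)
    (h : ∀ (G : C) [ComonObj G] [IsCommComonObj G] (q : G ⟶ Q) (a b : G ⟶ A), P G q →
      (q ⊠ (a ⊠ b) ≫ μ[A]) ≫ D = (a ⊠ (q ⊠ b) ≫ D) ≫ l + ((q ⊠ a) ≫ D ⊠ b) ≫ r) :
    IsDerivation l r D := by
  refine IsDerivation.of_comp_eq (hP.tens ((Detecting.all A).tens (Detecting.all A)) |>.hom_ext ?_)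
  rintro G _ _ _ ⟨q, _, hq, ⟨a, b, -, -, rfl⟩, rfl⟩
  simpa only [Preadditive.comp_add, ← Category.assoc, tens_whiskerLeft, tens_whiskerRight,
    tens_associator_hom, tens_associator_inv, tens_braiding_hom] using h G q a b hq

end Detecting

lemma T.tensor_tensor_hom_ext {C : Type u} [Category.{v} C] [MonoidalCategory C]
    [HasTensorAlgebras C] {X Y M Z : C}
    {a b : X ⊗ (Y ⊗ T M) ⟶ Z}
    (h : ∀ n, X ◁ Y ◁ T.inj M n ≫ a = X ◁ Y ◁ T.inj M n ≫ b) : a = b := by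
  rw [← cancel_epi (α_ X Y (T M)).hom]
  refine T.tensor_hom_ext fun n => ?_
  rw [associator_naturality_right_assoc, h, associator_naturality_right_assoc]

/-! ### Uniqueness and existence of derivations on a free monoid. -/

section FreeDerivations

variable {C : Type u} [Category.{v} C] [MonoidalCategory C] [SymmetricCategory C]
  [HasTensorAlgebras C]

lemma T.whiskerLeft_gen_mul (M : C) : T M ◁ T.gen M ≫ μ[T M] = T.append M := by
  have h : T M ◁ T.injOne M ≫ T.mul M =
      (α_ (T M) (𝟙_ C) M).inv ≫ (ρ_ (T M)).hom ▷ M ≫ T.append M := T.injSucc_mul M 0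
  change T M ◁ T.gen M ≫ T.mul M = _
  rw [T.gen, MonoidalCategory.whiskerLeft_comp, Category.assoc, h]
  simp

lemma T.tens_append {M G : C} [ComonObj G] (a : G ⟶ T M) (m : G ⟶ M) :
    (a ⊠ m) ≫ T.append M = (a ⊠ m ≫ T.gen M) ≫ μ[T M] := by
  rw [← T.whiskerLeft_gen_mul, ← Category.assoc, tens_whiskerLeft]

lemma T.tens_injSucc {M G : C} [ComonObj G] {n : ℕ} (w : G ⟶ tpow M n) (m : G ⟶ M) :
    (w ⊠ m) ≫ T.injSucc M n = (w ≫ T.inj M n ⊠ m ≫ T.gen M) ≫ μ[T M] := by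
  rw [← T.inj_append, ← T.tens_append, ← Category.assoc, tens_whiskerRight]

variable [Preadditive C] [MonoidalPreadditive C] [HasBinaryBiproducts C]
variable {M N Q : C}

/-- A derivation on a free monoid that vanishes on the generators is zero. -/
lemma IsDerivation.eq_zero {l : T M ⊗ N ⟶ N} {r : N ⊗ T M ⟶ N} {D : Q ⊗ T M ⟶ N}
    (hD : IsDerivation l r D) (h : IsUnitalPair l r) (hgen : Q ◁ T.gen M ≫ D = 0) : D = 0 := by
  refine T.tensor_hom_ext fun n => ?_
  rw [comp_zero]
  induction n with
  | zero =>
    change Q ◁ η[T M] ≫ D = 0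
    rw [← cancel_epi (ρ_ Q).inv]
    refine (Detecting.all Q).hom_ext fun G _ _ q _ => ?_
    simpa only [comp_zero, ← Category.assoc, comp_rightUnitor_inv, tens_whiskerLeft] using
      hD.one h q
  | succ n ih =>
    change Q ◁ T.injSucc M n ≫ D = 0
    refine ((Detecting.all Q).tens ((Detecting.all (tpow M n)).tens (Detecting.all M))).hom_ext ?_
    rintro G _ _ _ ⟨q, _, -, ⟨w, m, -, -, rfl⟩, rfl⟩
    have h₁ : (q ⊠ w ≫ T.inj M n) ≫ D = 0 := by
      rw [← tens_whiskerLeft, Category.assoc, ih, comp_zero]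
    have h₂ : (q ⊠ m ≫ T.gen M) ≫ D = 0 := by
      rw [← tens_whiskerLeft, Category.assoc, hgen, comp_zero]
    -- A word of length `n + 1` is a product `wm`, and `D` vanishes on `w` by induction and on `m`
    -- by hypothesis.
    rw [← Category.assoc, tens_whiskerLeft, T.tens_injSucc, hD, h₁, h₂, tens_zero, zero_tens]
    simp

/-- The components of the derivation `Q ⊗ T(M) ⟶ N` that extends `d`. -/
noncomputable def T.derivationComponent (l : T M ⊗ N ⟶ N) (r : N ⊗ T M ⟶ N) (d : Q ⊗ M ⟶ N) :
    ∀ n : ℕ, Q ⊗ tpow M n ⟶ N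
  | 0 => 0
  | n + 1 =>
    (α_ Q (tpow M n) M).inv ≫ ((β_ Q (tpow M n)).hom ▷ M ≫ (α_ (tpow M n) Q M).hom ≫
      (T.inj M n ⊗ₘ d) ≫ l + (T.derivationComponent l r d n ⊗ₘ T.gen M) ≫ r)

/-- The derivation `Q ⊗ T(M) ⟶ N` that extends `d`. -/
noncomputable def T.derivation (l : T M ⊗ N ⟶ N) (r : N ⊗ T M ⟶ N) (d : Q ⊗ M ⟶ N) :
    Q ⊗ T M ⟶ N :=
  T.tensorDesc (T.derivationComponent l r d)

section

variable {l : T M ⊗ N ⟶ N} {r : N ⊗ T M ⟶ N} {d : Q ⊗ M ⟶ N}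

lemma T.derivation_one : Q ◁ η[T M] ≫ T.derivation l r d = 0 :=
  T.inj_tensorDesc (T.derivationComponent l r d) 0

variable (l r d) in
-- The recursion defining the components is the Leibniz rule for `am` with `m` a generator. It holds
-- for arbitrary `l` and `r`, before any bimodule axiom.
lemma T.derivation_append {G : C} [ComonObj G] [IsCommComonObj G] (q : G ⟶ Q) (a : G ⟶ T M)
    (m : G ⟶ M) : (q ⊠ (a ⊠ m ≫ T.gen M) ≫ μ[T M]) ≫ T.derivation l r d =
      (a ⊠ (q ⊠ m) ≫ d) ≫ l + ((q ⊠ a) ≫ T.derivation l r d ⊠ m ≫ T.gen M) ≫ r := by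
  suffices h : Q ◁ T.append M ≫ T.derivation l r d = (α_ Q (T M) M).inv ≫
      ((β_ Q (T M)).hom ▷ M ≫ (α_ (T M) Q M).hom ≫ T M ◁ d ≫ l +
        (T.derivation l r d ⊗ₘ T.gen M) ≫ r) by
    have := whisker_eq (q ⊠ a ⊠ m) h
    simpa only [Preadditive.comp_add, ← Category.assoc, tens_whiskerLeft, tens_whiskerRight,
      tens_tensorHom, tens_associator_hom, tens_associator_inv, tens_braiding_hom,
      T.tens_append] using this
  refine T.tensor_hom_ext_right fun n => ?_
  refine ((Detecting.all Q).tens ((Detecting.all (tpow M n)).tens (Detecting.all M))).hom_ext ?_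
  rintro G _ _ _ ⟨q, _, -, ⟨w, m, -, -, rfl⟩, rfl⟩
  have h : Q ◁ T.injSucc M n ≫ T.derivation l r d = (α_ Q (tpow M n) M).inv ≫
      ((β_ Q (tpow M n)).hom ▷ M ≫ (α_ (tpow M n) Q M).hom ≫
        (T.inj M n ⊗ₘ d) ≫ l + (T.derivationComponent l r d n ⊗ₘ T.gen M) ≫ r) :=
    T.inj_tensorDesc (T.derivationComponent l r d) (n + 1)
  have h' : Q ◁ T.inj M n ≫ T.derivation l r d = T.derivationComponent l r d n :=
    T.inj_tensorDesc (T.derivationComponent l r d) n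
  rw [← h'] at h
  have := whisker_eq (q ⊠ w ⊠ m) h
  simpa only [Preadditive.comp_add, ← Category.assoc, tens_whiskerLeft, tens_whiskerRight,
    tens_tensorHom, tens_associator_hom, tens_associator_inv, tens_braiding_hom,
    T.tens_append, T.tens_injSucc] using this

/-- Write a generator as `1 · m`: the term `D(q, 1) m` vanishes and `1` acts trivially on `d(q, m)`.
-/
lemma T.derivation_gen (h : IsBimodule l r) : Q ◁ T.gen M ≫ T.derivation l r d = d := by
  refine ((Detecting.all Q).tens (Detecting.all M)).hom_ext ?_
  rintro G _ _ _ ⟨q, m, -, -, rfl⟩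
  have h₀ : (q ⊠ ε[G] ≫ η[T M]) ≫ T.derivation l r d = 0 := by
    rw [← tens_whiskerLeft, Category.assoc, T.derivation_one, comp_zero]
  have := T.derivation_append l r d q (ε[G] ≫ η[T M]) m
  rw [tens_one_mul, h.one_act, h₀, zero_tens, zero_comp, add_zero] at this
  rw [← Category.assoc, tens_whiskerLeft, this]

/-- Induction on the length of the second factor `b = wm`. The recursion rule is applied to `(aw)m`
and to `wm`, and the induction hypothesis to `aw`; the three associativity axioms of a bimodule
match the resulting terms. -/
lemma T.isDerivation_derivation (h : IsBimodule l r) : IsDerivation l r (T.derivation l r d) := by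
  set D := T.derivation l r d with hD
  refine IsDerivation.of_comp_eq ?_
  refine T.tensor_tensor_hom_ext fun n => ?_
  induction n with
  | zero =>
    change _ ◁ _ ◁ η[T M] ≫ _ = _ ◁ _ ◁ η[T M] ≫ _
    refine ((Detecting.all Q).tens ((Detecting.all (T M)).tens Detecting.unit)).hom_ext ?_
    rintro G _ _ _ ⟨q, _, -, ⟨a, _, -, rfl, rfl⟩, rfl⟩
    have h₀ : (q ⊠ ε[G] ≫ η[T M]) ≫ D = 0 := by
      rw [← tens_whiskerLeft, Category.assoc, T.derivation_one, comp_zero]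
    simp only [Preadditive.comp_add, ← Category.assoc, tens_whiskerLeft, tens_whiskerRight,
      tens_associator_hom, tens_associator_inv, tens_braiding_hom, h₀, h.act_one, tens_mul_one]
    simp [tens_zero]
  | succ n ih =>
    change _ ◁ _ ◁ T.injSucc M n ≫ _ = _ ◁ _ ◁ T.injSucc M n ≫ _
    refine ((Detecting.all Q).tens ((Detecting.all (T M)).tens
      ((Detecting.all (tpow M n)).tens (Detecting.all M)))).hom_ext ?_
    rintro G _ _ _ ⟨q, _, -, ⟨a, _, -, ⟨w, m, -, -, rfl⟩, rfl⟩, rfl⟩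
    have ih' := whisker_eq (q ⊠ a ⊠ w) ih
    simp only [Preadditive.comp_add, ← Category.assoc, tens_whiskerLeft, tens_whiskerRight,
      tens_associator_hom, tens_associator_inv, tens_braiding_hom] at ih'
    simp only [Preadditive.comp_add, ← Category.assoc, tens_whiskerLeft, tens_whiskerRight,
      tens_associator_hom, tens_associator_inv, tens_braiding_hom, T.tens_injSucc]
    rw [← tens_mul_assoc, hD, T.derivation_append, T.derivation_append, ← hD, ih', tens_add,
      add_tens, Preadditive.add_comp, Preadditive.add_comp, h.mul_act, h.act_comm, h.act_mul,
      add_assoc]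

end

end FreeDerivations

/-! ### The inner and the outer bimodule structure -/

section Actions

variable {C : Type u} [Category.{v} C] [MonoidalCategory C] [SymmetricCategory C]
variable (S : C)

/-- The exchange `(S ⊗ Y) ⊗ X ⟶ (S ⊗ X) ⊗ Y` of `X` and `Y`. -/
def exchange (X Y : C) : (S ⊗ Y) ⊗ X ⟶ (S ⊗ X) ⊗ Y :=
  (α_ S Y X).hom ≫ S ◁ (β_ Y X).hom ≫ (α_ S X Y).inv

/-- The outer left action `A ⊗ (ΣA ⊗ A) ⟶ ΣA ⊗ A`, `a ⊗ (Σx ⊗ y) ↦ Σax ⊗ y`. -/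
def outerLeft (A : C) [MonObj A] : A ⊗ ((S ⊗ A) ⊗ A) ⟶ (S ⊗ A) ⊗ A :=
  (α_ A (S ⊗ A) A).inv ≫ (α_ A S A).inv ▷ A ≫ (β_ A S).hom ▷ A ▷ A ≫ (α_ S A A).hom ▷ A ≫
    (S ◁ μ[A]) ▷ A

/-- The outer right action `(ΣA ⊗ A) ⊗ A ⟶ ΣA ⊗ A`, `(Σx ⊗ y) ⊗ b ↦ Σx ⊗ yb`. -/
def outerRight (A : C) [MonObj A] : ((S ⊗ A) ⊗ A) ⊗ A ⟶ (S ⊗ A) ⊗ A :=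
  (α_ (S ⊗ A) A A).hom ≫ (S ⊗ A) ◁ μ[A]

section Pure

variable {S} {G : C} [ComonObj G] [IsCommComonObj G]

lemma tens_exchange {X Y : C} (s : G ⟶ S) (y : G ⟶ Y) (x : G ⟶ X) :
    ((s ⊠ y) ⊠ x) ≫ exchange S X Y = (s ⊠ x) ⊠ y := by
  simp only [exchange, ← Category.assoc, tens_associator_hom, tens_whiskerLeft,
    tens_braiding_hom, tens_associator_inv]

variable {A : C}

lemma tens_swapOut [Preadditive C] (s : G ⟶ S) (x y : G ⟶ A) :
    ((s ⊠ x) ⊠ y) ≫ swapOut S A = (s ⊠ y) ⊠ x := tens_exchange s x y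

variable [MonObj A]

lemma tens_innerLeft [Preadditive C] (s : G ⟶ S) (a x y : G ⟶ A) :
    (a ⊠ (s ⊠ x) ⊠ y) ≫ innerLeft S A = (s ⊠ x) ⊠ (a ⊠ y) ≫ μ[A] := by
  simp only [innerLeft, ← Category.assoc, tens_associator_hom, tens_whiskerLeft,
    tens_whiskerRight, tens_braiding_hom, tens_associator_inv]

lemma tens_innerRight [Preadditive C] (s : G ⟶ S) (b x y : G ⟶ A) :
    (((s ⊠ x) ⊠ y) ⊠ b) ≫ innerRight S A = (s ⊠ (x ⊠ b) ≫ μ[A]) ⊠ y := by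
  simp only [innerRight, ← Category.assoc, tens_associator_hom, tens_whiskerLeft,
    tens_whiskerRight, tens_braiding_hom, tens_associator_inv]

lemma tens_outerLeft (s : G ⟶ S) (a x y : G ⟶ A) :
    (a ⊠ (s ⊠ x) ⊠ y) ≫ outerLeft S A = (s ⊠ (a ⊠ x) ≫ μ[A]) ⊠ y := by
  simp only [outerLeft, ← Category.assoc, tens_associator_hom, tens_whiskerLeft,
    tens_whiskerRight, tens_braiding_hom, tens_associator_inv]

lemma tens_outerRight (s : G ⟶ S) (b x y : G ⟶ A) :
    (((s ⊠ x) ⊠ y) ⊠ b) ≫ outerRight S A = (s ⊠ x) ⊠ (y ⊠ b) ≫ μ[A] := by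
  simp only [outerRight, ← Category.assoc, tens_associator_hom, tens_whiskerLeft]

end Pure

variable [Preadditive C] [HasBinaryBiproducts C] [MonoidalPreadditive C]

variable {S} {A : C}

/-- Pure tensors in `(S ⊗ X) ⊗ Y`. -/
lemma detecting_tens₃ (S X Y : C) : Detecting (X := (S ⊗ X) ⊗ Y) fun G _ _ n =>
    ∃ (s : G ⟶ S) (x : G ⟶ X) (y : G ⟶ Y), n = (s ⊠ x) ⊠ y where
  exists_splitEpi := by
    obtain ⟨G, i, j, _, ⟨_, y, ⟨s, x, -, -, rfl⟩, -, rfl⟩, h⟩ :=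
      (((Detecting.all S).tens (Detecting.all X)).tens (Detecting.all Y)).exists_splitEpi
    exact ⟨G, i, j, _, ⟨s, x, y, rfl⟩, h⟩
  comp φ _ _ := by
    rintro ⟨s, x, y, rfl⟩
    exact ⟨φ ≫ s, φ ≫ x, φ ≫ y, by rw [comp_tens, comp_tens]⟩

lemma exchange_exchange (S X Y : C) : exchange S X Y ≫ exchange S Y X = 𝟙 _ := by
  simp [exchange, ← MonoidalCategory.whiskerLeft_comp_assoc]

variable [MonObj A]

/-! ### Interplay of the inner and outer actions. -/

section ElementActions

variable {G : C} [ComonObj G] [IsCommComonObj G]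

/-- The value `n` of a bracket need not be a pure tensor. The identity is therefore proved as a
diagram, tested on pure tensors, and then evaluated at `n`; the same device recurs below. -/
lemma tens_swapOut_innerLeft (a : G ⟶ A) (n : G ⟶ (S ⊗ A) ⊗ A) :
    (a ⊠ n ≫ swapOut S A) ≫ innerLeft S A = (a ⊠ n) ≫ outerLeft S A ≫ swapOut S A := by
  have h : A ◁ swapOut S A ≫ innerLeft S A = outerLeft S A ≫ swapOut S A := by
    refine ((Detecting.all A).tens (detecting_tens₃ S A A)).hom_ext ?_
    rintro G _ _ _ ⟨a, _, -, ⟨s, x, y, rfl⟩, rfl⟩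
    simp only [← Category.assoc, tens_whiskerLeft, tens_swapOut, tens_innerLeft, tens_outerLeft]
  rw [← h, ← Category.assoc, tens_whiskerLeft]

lemma tens_swapOut_outerLeft (a : G ⟶ A) (n : G ⟶ (S ⊗ A) ⊗ A) :
    (a ⊠ n ≫ swapOut S A) ≫ outerLeft S A = (a ⊠ n) ≫ innerLeft S A ≫ swapOut S A := by
  have h : A ◁ swapOut S A ≫ outerLeft S A = innerLeft S A ≫ swapOut S A := by
    refine ((Detecting.all A).tens (detecting_tens₃ S A A)).hom_ext ?_
    rintro G _ _ _ ⟨a, _, -, ⟨s, x, y, rfl⟩, rfl⟩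
    simp only [← Category.assoc, tens_whiskerLeft, tens_swapOut, tens_innerLeft, tens_outerLeft]
  rw [← h, ← Category.assoc, tens_whiskerLeft]

lemma tens_swapOut_innerRight (a : G ⟶ A) (n : G ⟶ (S ⊗ A) ⊗ A) :
    (n ≫ swapOut S A ⊠ a) ≫ innerRight S A = (n ⊠ a) ≫ outerRight S A ≫ swapOut S A := by
  have h : swapOut S A ▷ A ≫ innerRight S A = outerRight S A ≫ swapOut S A := by
    refine ((detecting_tens₃ S A A).tens (Detecting.all A)).hom_ext ?_
    rintro G _ _ _ ⟨_, a, ⟨s, x, y, rfl⟩, -, rfl⟩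
    simp only [← Category.assoc, tens_whiskerRight, tens_swapOut, tens_innerRight, tens_outerRight]
  rw [← h, ← Category.assoc, tens_whiskerRight]

lemma tens_swapOut_outerRight (a : G ⟶ A) (n : G ⟶ (S ⊗ A) ⊗ A) :
    (n ≫ swapOut S A ⊠ a) ≫ outerRight S A = (n ⊠ a) ≫ innerRight S A ≫ swapOut S A := by
  have h : swapOut S A ▷ A ≫ outerRight S A = innerRight S A ≫ swapOut S A := by
    refine ((detecting_tens₃ S A A).tens (Detecting.all A)).hom_ext ?_
    rintro G _ _ _ ⟨_, a, ⟨s, x, y, rfl⟩, -, rfl⟩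
    simp only [← Category.assoc, tens_whiskerRight, tens_swapOut, tens_innerRight, tens_outerRight]
  rw [← h, ← Category.assoc, tens_whiskerRight]

/-- Together with the next three lemmas: an inner and an outer action commute, since they affect
different factors of `ΣA ⊗ A` or opposite sides of the same one. This makes the defect of the right
derivation property a left derivation. -/
lemma tens_innerLeft_outerLeft (a b : G ⟶ A) (n : G ⟶ (S ⊗ A) ⊗ A) :
    (a ⊠ (b ⊠ n) ≫ outerLeft S A) ≫ innerLeft S A =
      (b ⊠ (a ⊠ n) ≫ innerLeft S A) ≫ outerLeft S A := by
  have h : A ◁ outerLeft S A ≫ innerLeft S A = (α_ A A ((S ⊗ A) ⊗ A)).inv ≫ (β_ A A).hom ▷ _ ≫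
      (α_ _ _ _).hom ≫ A ◁ innerLeft S A ≫ outerLeft S A := by
    refine ((Detecting.all A).tens ((Detecting.all A).tens (detecting_tens₃ S A A))).hom_ext ?_
    rintro G _ _ _ ⟨a, _, -, ⟨b, _, -, ⟨s, x, y, rfl⟩, rfl⟩, rfl⟩
    simp only [← Category.assoc, tens_whiskerLeft, tens_whiskerRight, tens_associator_inv,
      tens_associator_hom, tens_braiding_hom, tens_innerLeft, tens_outerLeft]
  simpa only [← Category.assoc, tens_whiskerLeft, tens_whiskerRight, tens_associator_inv,
      tens_associator_hom, tens_braiding_hom] using whisker_eq (a ⊠ b ⊠ n) h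

lemma tens_innerLeft_outerRight (a b : G ⟶ A) (n : G ⟶ (S ⊗ A) ⊗ A) :
    (a ⊠ (n ⊠ b) ≫ outerRight S A) ≫ innerLeft S A =
      ((a ⊠ n) ≫ innerLeft S A ⊠ b) ≫ outerRight S A := by
  have h : A ◁ outerRight S A ≫ innerLeft S A = (α_ A ((S ⊗ A) ⊗ A) A).inv ≫
      innerLeft S A ▷ A ≫ outerRight S A := by
    refine ((Detecting.all A).tens ((detecting_tens₃ S A A).tens (Detecting.all A))).hom_ext ?_
    rintro G _ _ _ ⟨a, _, -, ⟨_, b, ⟨s, x, y, rfl⟩, -, rfl⟩, rfl⟩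
    simp only [← Category.assoc, tens_whiskerLeft, tens_whiskerRight, tens_associator_inv,
      tens_innerLeft, tens_outerRight, tens_mul_assoc]
  simpa only [← Category.assoc, tens_whiskerLeft, tens_whiskerRight, tens_associator_inv]
    using whisker_eq (a ⊠ n ⊠ b) h

lemma tens_innerRight_outerLeft (a b : G ⟶ A) (n : G ⟶ (S ⊗ A) ⊗ A) :
    ((a ⊠ n) ≫ outerLeft S A ⊠ b) ≫ innerRight S A =
      (a ⊠ (n ⊠ b) ≫ innerRight S A) ≫ outerLeft S A := by
  have h : outerLeft S A ▷ A ≫ innerRight S A = (α_ A ((S ⊗ A) ⊗ A) A).hom ≫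
      A ◁ innerRight S A ≫ outerLeft S A := by
    refine (((Detecting.all A).tens (detecting_tens₃ S A A)).tens (Detecting.all A)).hom_ext ?_
    rintro G _ _ _ ⟨_, b, ⟨a, _, -, ⟨s, x, y, rfl⟩, rfl⟩, -, rfl⟩
    simp only [← Category.assoc, tens_whiskerLeft, tens_whiskerRight, tens_associator_hom,
      tens_innerRight, tens_outerLeft, tens_mul_assoc]
  simpa only [← Category.assoc, tens_whiskerLeft, tens_whiskerRight, tens_associator_hom]
    using whisker_eq ((a ⊠ n) ⊠ b) h

lemma tens_innerRight_outerRight (a b : G ⟶ A) (n : G ⟶ (S ⊗ A) ⊗ A) :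
    ((n ⊠ b) ≫ outerRight S A ⊠ a) ≫ innerRight S A =
      ((n ⊠ a) ≫ innerRight S A ⊠ b) ≫ outerRight S A := by
  have h : outerRight S A ▷ A ≫ innerRight S A = (α_ ((S ⊗ A) ⊗ A) A A).hom ≫
      _ ◁ (β_ A A).hom ≫ (α_ _ _ _).inv ≫ innerRight S A ▷ A ≫ outerRight S A := by
    refine (((detecting_tens₃ S A A).tens (Detecting.all A)).tens (Detecting.all A)).hom_ext ?_
    rintro G _ _ _ ⟨_, a, ⟨_, b, ⟨s, x, y, rfl⟩, -, rfl⟩, -, rfl⟩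
    simp only [← Category.assoc, tens_whiskerLeft, tens_whiskerRight, tens_associator_inv,
      tens_associator_hom, tens_braiding_hom, tens_innerRight, tens_outerRight]
  simpa only [← Category.assoc, tens_whiskerLeft, tens_whiskerRight, tens_associator_inv,
      tens_associator_hom, tens_braiding_hom] using whisker_eq ((n ⊠ b) ⊠ a) h

end ElementActions

/-- Bimodule axioms can be checked on a detecting class of elements. -/
lemma IsBimodule.of_detecting {N : C} {l : A ⊗ N ⟶ N} {r : N ⊗ A ⟶ N}
    {P : ∀ (G : C) [ComonObj G] [IsCommComonObj G], (G ⟶ N) → Prop} (hP : Detecting P)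
    (h₁ : ∀ (G : C) [ComonObj G] [IsCommComonObj G] (n : G ⟶ N), P G n →
      (ε[G] ≫ η[A] ⊠ n) ≫ l = n)
    (h₂ : ∀ (G : C) [ComonObj G] [IsCommComonObj G] (n : G ⟶ N), P G n →
      (n ⊠ ε[G] ≫ η[A]) ≫ r = n)
    (h₃ : ∀ (G : C) [ComonObj G] [IsCommComonObj G] (a b : G ⟶ A) (n : G ⟶ N), P G n →
      ((a ⊠ b) ≫ μ[A] ⊠ n) ≫ l = (a ⊠ (b ⊠ n) ≫ l) ≫ l)
    (h₄ : ∀ (G : C) [ComonObj G] [IsCommComonObj G] (a b : G ⟶ A) (n : G ⟶ N), P G n →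
      (n ⊠ (a ⊠ b) ≫ μ[A]) ≫ r = ((n ⊠ a) ≫ r ⊠ b) ≫ r)
    (h₅ : ∀ (G : C) [ComonObj G] [IsCommComonObj G] (a b : G ⟶ A) (n : G ⟶ N), P G n →
      ((a ⊠ n) ≫ l ⊠ b) ≫ r = (a ⊠ (n ⊠ b) ≫ r) ≫ l) : IsBimodule l r where
  one_act n := by
    have h : (λ_ N).inv ≫ η[A] ▷ N ≫ l = 𝟙 N := hP.hom_ext fun G _ _ n hn => by
      simpa only [← Category.assoc, comp_leftUnitor_inv, tens_whiskerRight, Category.comp_id]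
        using h₁ G n hn
    simpa only [← Category.assoc, comp_leftUnitor_inv, tens_whiskerRight, Category.comp_id]
      using whisker_eq n h
  act_one n := by
    have h : (ρ_ N).inv ≫ N ◁ η[A] ≫ r = 𝟙 N := hP.hom_ext fun G _ _ n hn => by
      simpa only [← Category.assoc, comp_rightUnitor_inv, tens_whiskerLeft, Category.comp_id]
        using h₂ G n hn
    simpa only [← Category.assoc, comp_rightUnitor_inv, tens_whiskerLeft, Category.comp_id]
      using whisker_eq n h
  mul_act a b n := by
    have h : μ[A] ▷ N ≫ l = (α_ A A N).hom ≫ A ◁ l ≫ l := by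
      refine (((Detecting.all A).tens (Detecting.all A)).tens hP).hom_ext ?_
      rintro G _ _ _ ⟨_, n, ⟨a, b, -, -, rfl⟩, hn, rfl⟩
      simpa only [← Category.assoc, tens_associator_hom, tens_whiskerRight, tens_whiskerLeft]
        using h₃ G a b n hn
    simpa only [← Category.assoc, tens_associator_hom, tens_whiskerRight, tens_whiskerLeft]
      using whisker_eq ((a ⊠ b) ⊠ n) h
  act_mul a b n := by
    have h : N ◁ μ[A] ≫ r = (α_ N A A).inv ≫ r ▷ A ≫ r := by
      refine (hP.tens ((Detecting.all A).tens (Detecting.all A))).hom_ext ?_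
      rintro G _ _ _ ⟨n, _, hn, ⟨a, b, -, -, rfl⟩, rfl⟩
      simpa only [← Category.assoc, tens_associator_inv, tens_whiskerRight, tens_whiskerLeft]
        using h₄ G a b n hn
    simpa only [← Category.assoc, tens_associator_inv, tens_whiskerRight, tens_whiskerLeft]
      using whisker_eq (n ⊠ a ⊠ b) h
  act_comm a b n := by
    have h : l ▷ A ≫ r = (α_ A N A).hom ≫ A ◁ r ≫ l := by
      refine (((Detecting.all A).tens hP).tens (Detecting.all A)).hom_ext ?_
      rintro G _ _ _ ⟨_, b, ⟨a, n, -, hn, rfl⟩, -, rfl⟩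
      simpa only [← Category.assoc, tens_associator_hom, tens_whiskerRight, tens_whiskerLeft]
        using h₅ G a b n hn
    simpa only [← Category.assoc, tens_associator_hom, tens_whiskerRight, tens_whiskerLeft]
      using whisker_eq ((a ⊠ n) ⊠ b) h

variable (S A)

lemma isBimodule_inner : IsBimodule (innerLeft S A) (innerRight S A) := by
  refine IsBimodule.of_detecting (detecting_tens₃ S A A) ?_ ?_ ?_ ?_ ?_
  · rintro G _ _ _ ⟨s, x, y, rfl⟩
    rw [tens_innerLeft, tens_one_mul]
  · rintro G _ _ _ ⟨s, x, y, rfl⟩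
    rw [tens_innerRight, tens_mul_one]
  · rintro G _ _ a b _ ⟨s, x, y, rfl⟩
    simp only [tens_innerLeft, tens_mul_assoc]
  · rintro G _ _ a b _ ⟨s, x, y, rfl⟩
    simp only [tens_innerRight, tens_mul_assoc]
  · rintro G _ _ a b _ ⟨s, x, y, rfl⟩
    simp only [tens_innerRight, tens_innerLeft]

lemma isBimodule_outer : IsBimodule (outerLeft S A) (outerRight S A) := by
  refine IsBimodule.of_detecting (detecting_tens₃ S A A) ?_ ?_ ?_ ?_ ?_
  · rintro G _ _ _ ⟨s, x, y, rfl⟩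
    rw [tens_outerLeft, tens_one_mul]
  · rintro G _ _ _ ⟨s, x, y, rfl⟩
    rw [tens_outerRight, tens_mul_one]
  · rintro G _ _ a b _ ⟨s, x, y, rfl⟩
    simp only [tens_outerLeft, tens_mul_assoc]
  · rintro G _ _ a b _ ⟨s, x, y, rfl⟩
    simp only [tens_outerRight, tens_mul_assoc]
  · rintro G _ _ a b _ ⟨s, x, y, rfl⟩
    simp only [tens_outerRight, tens_outerLeft]

end Actions

/-! ### Left and right derivation properties -/

section Properties

variable {C : Type u} [Category.{v} C] [MonoidalCategory C] [SymmetricCategory C]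
  [Preadditive C] [HasBinaryBiproducts C] [MonoidalPreadditive C]
variable {S A : C} [MonObj A]

/-- The parameter consists of the `Σ` of the first argument and the whole second argument;
`exchange` moves the variable `A` to the end, where `IsDerivation` expects it. -/
lemma isLeftDerivation_iff {f : DoubleBracket S A} : IsLeftDerivation S f ↔
    IsDerivation (innerLeft S A) (innerRight S A) (exchange S A (S ⊗ A) ≫ f) := by
  constructor
  · intro h
    refine IsDerivation.of_detecting ((Detecting.all S).tens (Detecting.all (S ⊗ A))) ?_
    rintro G _ _ _ a b ⟨s, n, -, -, rfl⟩
    simpa only [Preadditive.comp_add, ← Category.assoc, tens_exchange, tens_whiskerLeft,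
      tens_whiskerRight, tens_associator_hom, tens_associator_inv, tens_braiding_hom] using
      whisker_eq ((s ⊠ (a ⊠ b)) ⊠ n) h
  · intro h
    refine (((Detecting.all S).tens ((Detecting.all A).tens (Detecting.all A))).tens
      (Detecting.all (S ⊗ A))).hom_ext ?_
    rintro G _ _ _ ⟨_, n, ⟨s, _, -, ⟨a, b, -, -, rfl⟩, rfl⟩, -, rfl⟩
    have := h G (s ⊠ n) a b
    simpa only [Preadditive.comp_add, ← Category.assoc, tens_exchange, tens_whiskerLeft,
      tens_whiskerRight, tens_associator_hom, tens_associator_inv, tens_braiding_hom] using this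

variable (S) in
/-- The right derivation property: `f` is a derivation in its second variable for the outer
bimodule structure of `ΣA ⊗ A`. -/
def IsRightDerivation (f : DoubleBracket S A) : Prop :=
  IsDerivation (outerLeft S A) (outerRight S A) ((α_ (S ⊗ A) S A).hom ≫ f)

section

variable {f : DoubleBracket S A} {G : C} [ComonObj G] [IsCommComonObj G]

lemma IsLeftDerivation.tens (h : IsLeftDerivation S f) (s : G ⟶ S) (a b : G ⟶ A)
    (n : G ⟶ S ⊗ A) : ((s ⊠ (a ⊠ b) ≫ μ[A]) ⊠ n) ≫ f =
      (a ⊠ ((s ⊠ b) ⊠ n) ≫ f) ≫ innerLeft S A + (((s ⊠ a) ⊠ n) ≫ f ⊠ b) ≫ innerRight S A := by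
  simpa only [← Category.assoc, tens_exchange] using isLeftDerivation_iff.1 h G (s ⊠ n) a b

lemma IsRightDerivation.tens (h : IsRightDerivation S f) (n : G ⟶ S ⊗ A) (t : G ⟶ S)
    (a b : G ⟶ A) : (n ⊠ t ⊠ (a ⊠ b) ≫ μ[A]) ≫ f =
      (a ⊠ (n ⊠ t ⊠ b) ≫ f) ≫ outerLeft S A + ((n ⊠ t ⊠ a) ≫ f ⊠ b) ≫ outerRight S A := by
  simpa only [← Category.assoc, tens_associator_hom] using h G (n ⊠ t) a b

omit [HasBinaryBiproducts C] [MonObj A] in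
lemma IsAntisymmetric.tens (h : IsAntisymmetric S f) (m n : G ⟶ S ⊗ A) :
    (m ⊠ n) ≫ f = -((n ⊠ m) ≫ f ≫ swapOut S A) := by
  simpa only [Preadditive.comp_neg, ← Category.assoc, tens_braiding_hom] using
    whisker_eq (m ⊠ n) h

end

/-- `swapOut` carries the inner actions to the outer ones. -/
lemma IsLeftDerivation.swap {f : DoubleBracket S A} (h : IsLeftDerivation S f) :
    IsRightDerivation S ((β_ (S ⊗ A) (S ⊗ A)).hom ≫ f ≫ swapOut S A) := by
  refine IsDerivation.of_detecting ((Detecting.all (S ⊗ A)).tens (Detecting.all S)) ?_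
  rintro G _ _ _ a b ⟨n, t, -, -, rfl⟩
  simp only [← Category.assoc, tens_associator_hom, tens_braiding_hom, h.tens,
    Preadditive.add_comp, tens_swapOut_outerLeft, tens_swapOut_outerRight]

lemma IsRightDerivation.swap {f : DoubleBracket S A} (h : IsRightDerivation S f) :
    IsLeftDerivation S ((β_ (S ⊗ A) (S ⊗ A)).hom ≫ f ≫ swapOut S A) := by
  rw [isLeftDerivation_iff]
  refine IsDerivation.of_detecting ((Detecting.all S).tens (Detecting.all (S ⊗ A))) ?_
  rintro G _ _ _ a b ⟨t, n, -, -, rfl⟩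
  simp only [← Category.assoc, tens_exchange, tens_braiding_hom, h.tens,
    Preadditive.add_comp, tens_swapOut_innerLeft, tens_swapOut_innerRight]

lemma IsLeftDerivation.isRightDerivation {f : DoubleBracket S A} (h : IsLeftDerivation S f)
    (hf : IsAntisymmetric S f) : IsRightDerivation S f := by
  have := h.swap
  unfold IsAntisymmetric at hf
  rw [hf]
  unfold IsRightDerivation at this ⊢
  rw [Preadditive.comp_neg]
  exact this.neg

/-! ### Restriction along a monoid morphism. -/

section Pullback

variable {B N Q : C} [MonObj B]

/-- Uniqueness of derivations uses only the unit laws, so these are all that has to be transported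
along `φ`. -/
lemma IsUnitalPair.pullback {l : B ⊗ N ⟶ N} {r : N ⊗ B ⟶ N} (h : IsUnitalPair l r) (φ : A ⟶ B)
    [IsMonHom φ] : IsUnitalPair (φ ▷ N ≫ l) (N ◁ φ ≫ r) where
  one_act n := by
    rw [← Category.assoc, tens_whiskerRight, Category.assoc, IsMonHom.one_hom, h.one_act]
  act_one n := by
    rw [← Category.assoc, tens_whiskerLeft, Category.assoc, IsMonHom.one_hom, h.act_one]

lemma IsDerivation.pullback {l : B ⊗ N ⟶ N} {r : N ⊗ B ⟶ N} {D : Q ⊗ B ⟶ N}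
    (h : IsDerivation l r D) (φ : A ⟶ B) [IsMonHom φ] :
    IsDerivation (φ ▷ N ≫ l) (N ◁ φ ≫ r) (Q ◁ φ ≫ D) := by
  intro G _ _ q a b
  have hm : ((a ⊠ b) ≫ μ[A]) ≫ φ = (a ≫ φ ⊠ b ≫ φ) ≫ μ[B] := by
    rw [Category.assoc, IsMonHom.mul_hom, ← Category.assoc, tens_tensorHom]
  simpa only [← Category.assoc, tens_whiskerLeft, tens_whiskerRight, hm] using
    h G q (a ≫ φ) (b ≫ φ)

end Pullback

section Naturality

variable {B : C} [MonObj B] (S) (φ : A ⟶ B) [IsMonHom φ]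

lemma innerLeft_naturality : innerLeft S A ≫ (S ◁ φ ⊗ₘ φ) =
    A ◁ (S ◁ φ ⊗ₘ φ) ≫ φ ▷ _ ≫ innerLeft S B := by
  refine ((Detecting.all A).tens (detecting_tens₃ S A A)).hom_ext ?_
  rintro G _ _ _ ⟨a, _, -, ⟨s, x, y, rfl⟩, rfl⟩
  simp only [← Category.assoc, tens_whiskerLeft, tens_whiskerRight, tens_tensorHom,
    tens_innerLeft]
  rw [← tens_tensorHom a, Category.assoc, Category.assoc, IsMonHom.mul_hom]

lemma outerLeft_naturality : outerLeft S A ≫ (S ◁ φ ⊗ₘ φ) =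
    A ◁ (S ◁ φ ⊗ₘ φ) ≫ φ ▷ _ ≫ outerLeft S B := by
  refine ((Detecting.all A).tens (detecting_tens₃ S A A)).hom_ext ?_
  rintro G _ _ _ ⟨a, _, -, ⟨s, x, y, rfl⟩, rfl⟩
  simp only [← Category.assoc, tens_whiskerLeft, tens_whiskerRight, tens_tensorHom,
    tens_outerLeft]
  rw [← tens_tensorHom a, Category.assoc, Category.assoc, IsMonHom.mul_hom]

lemma innerRight_naturality : innerRight S A ≫ (S ◁ φ ⊗ₘ φ) =
    (S ◁ φ ⊗ₘ φ) ▷ A ≫ _ ◁ φ ≫ innerRight S B := by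
  refine ((detecting_tens₃ S A A).tens (Detecting.all A)).hom_ext ?_
  rintro G _ _ _ ⟨_, a, ⟨s, x, y, rfl⟩, -, rfl⟩
  simp only [← Category.assoc, tens_whiskerLeft, tens_whiskerRight, tens_tensorHom,
    tens_innerRight]
  rw [← tens_tensorHom x, Category.assoc, Category.assoc, IsMonHom.mul_hom]

lemma outerRight_naturality : outerRight S A ≫ (S ◁ φ ⊗ₘ φ) =
    (S ◁ φ ⊗ₘ φ) ▷ A ≫ _ ◁ φ ≫ outerRight S B := by
  refine ((detecting_tens₃ S A A).tens (Detecting.all A)).hom_ext ?_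
  rintro G _ _ _ ⟨_, a, ⟨s, x, y, rfl⟩, -, rfl⟩
  simp only [← Category.assoc, tens_whiskerLeft, tens_whiskerRight, tens_tensorHom,
    tens_outerRight]
  rw [← tens_tensorHom y, Category.assoc, Category.assoc, IsMonHom.mul_hom]

end Naturality

end Properties

/-! ### Extension of a double bracket to the free monoid -/

section Extension

variable {C : Type u} [Category.{v} C] [MonoidalCategory C] [SymmetricCategory C]
  [HasTensorAlgebras C] [Preadditive C] [HasBinaryBiproducts C] [MonoidalPreadditive C]
variable {S M N : C}

/-- A morphism on `ΣT(M) ⊗ ΣT(M)` that is a derivation in both variables is determined by its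
restriction to generators. -/
lemma biderivation_eq_zero {l l' : T M ⊗ N ⟶ N} {r r' : N ⊗ T M ⟶ N}
    {E : (S ⊗ T M) ⊗ (S ⊗ T M) ⟶ N} (h : IsUnitalPair l r) (h' : IsUnitalPair l' r')
    (hE : IsDerivation l r (exchange S (T M) (S ⊗ T M) ≫ E))
    (hE' : IsDerivation l' r' ((α_ (S ⊗ T M) S (T M)).hom ≫ E))
    (hgen : (S ◁ T.gen M ⊗ₘ S ◁ T.gen M) ≫ E = 0) : E = 0 := by
  -- With a generator in the first argument, the derivation in the second variable vanishes. This is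
  -- the vanishing on generators needed for the first variable.
  have h₁ : (S ◁ T.gen M) ▷ S ▷ T M ≫ (α_ (S ⊗ T M) S (T M)).hom ≫ E = 0 := by
    refine (hE'.whiskerRight_comp ((S ◁ T.gen M) ▷ S)).eq_zero h' ?_
    refine (((Detecting.all (S ⊗ M)).tens (Detecting.all S)).tens (Detecting.all M)).hom_ext ?_
    rintro G _ _ _ ⟨_, x, ⟨n, t, -, -, rfl⟩, -, rfl⟩
    simpa only [← Category.assoc, tens_whiskerLeft, tens_whiskerRight, tens_associator_hom,
      tens_tensorHom, comp_zero] using whisker_eq (n ⊠ t ⊠ x) hgen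
  have h₂ : exchange S (T M) (S ⊗ T M) ≫ E = 0 := by
    refine hE.eq_zero h ?_
    refine (((Detecting.all S).tens ((Detecting.all S).tens (Detecting.all (T M)))).tens
      (Detecting.all M)).hom_ext ?_
    rintro G _ _ _ ⟨_, m, ⟨s, _, -, ⟨t, a, -, -, rfl⟩, rfl⟩, -, rfl⟩
    simpa only [← Category.assoc, tens_whiskerLeft, tens_whiskerRight, tens_associator_hom,
      tens_tensorHom, comp_zero, tens_exchange] using whisker_eq (((s ⊠ m) ⊠ t) ⊠ a) h₁
  rw [← Category.id_comp E, ← exchange_exchange, Category.assoc, h₂, comp_zero]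

variable (f : DoubleBracket S M)

/-- The extension of a double bracket on `M` to a morphism on `ΣM ⊗ ΣT(M)`. -/
noncomputable def extendRight : (S ⊗ M) ⊗ (S ⊗ T M) ⟶ (S ⊗ T M) ⊗ T M :=
  (α_ (S ⊗ M) S (T M)).inv ≫ T.derivation (outerLeft S (T M)) (outerRight S (T M))
    ((α_ (S ⊗ M) S M).hom ≫ f ≫ (S ◁ T.gen M ⊗ₘ T.gen M))

/-- The extension of a double bracket on `M` to a double bracket on `T(M)`. -/
noncomputable def extend : DoubleBracket S (T M) :=
  exchange S (S ⊗ T M) (T M) ≫ T.derivation (innerLeft S (T M)) (innerRight S (T M))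
    (exchange S M (S ⊗ T M) ≫ extendRight f)

lemma whiskerLeft_gen_extendRight : (S ⊗ M) ◁ S ◁ T.gen M ≫ extendRight f =
    f ≫ (S ◁ T.gen M ⊗ₘ T.gen M) := by
  rw [extendRight, associator_inv_naturality_right_assoc, T.derivation_gen (isBimodule_outer S _)]
  simp

lemma gen_whiskerRight_extend : (S ◁ T.gen M) ▷ (S ⊗ T M) ≫ extend f = extendRight f := by
  have h := T.derivation_gen (d := exchange S M (S ⊗ T M) ≫ extendRight f)
    (isBimodule_inner S (T M))
  refine (((Detecting.all S).tens (Detecting.all M)).tens (Detecting.all (S ⊗ T M))).hom_ext ?_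
  rintro G _ _ _ ⟨_, n, ⟨s, m, -, -, rfl⟩, -, rfl⟩
  simpa only [extend, ← Category.assoc, tens_whiskerLeft, tens_whiskerRight, tens_exchange] using
    whisker_eq ((s ⊠ n) ⊠ m) h

lemma isBracketHom_extend : IsBracketHom S f (extend f) (T.gen M) := by
  rw [IsBracketHom, MonoidalCategory.tensorHom_def', Category.assoc, gen_whiskerRight_extend,
    whiskerLeft_gen_extendRight]

lemma isLeftDerivation_extend : IsLeftDerivation S (extend f) := by
  rw [isLeftDerivation_iff, extend, ← Category.assoc, exchange_exchange, Category.id_comp]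
  exact T.isDerivation_derivation (isBimodule_inner S _)

lemma isDerivation_extendRight : IsDerivation (outerLeft S (T M)) (outerRight S (T M))
    ((α_ (S ⊗ M) S (T M)).hom ≫ extendRight f) := by
  rw [extendRight, Iso.hom_inv_id_assoc]
  exact T.isDerivation_derivation (isBimodule_outer S _)

/-- The defect of the right derivation property. -/
noncomputable def rightDefect {A : C} [MonObj A] (f : DoubleBracket S A) :
    (S ⊗ A) ⊗ (S ⊗ (A ⊗ A)) ⟶ (S ⊗ A) ⊗ A :=
  (S ⊗ A) ◁ S ◁ μ[A] ≫ f -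
    ((S ⊗ A) ◁ ((α_ S A A).inv ≫ (β_ S A).hom ▷ A ≫ (α_ A S A).hom) ≫ (α_ _ A _).inv ≫
      (β_ _ A).hom ▷ _ ≫ (α_ A _ _).hom ≫ A ◁ f ≫ outerLeft S A +
    (S ⊗ A) ◁ (α_ S A A).inv ≫ (α_ _ _ A).inv ≫ f ▷ A ≫ outerRight S A)

lemma tens_rightDefect {A : C} [MonObj A] (f : DoubleBracket S A) {G : C} [ComonObj G]
    [IsCommComonObj G] (n : G ⟶ S ⊗ A) (t : G ⟶ S) (x y : G ⟶ A) :
    (n ⊠ t ⊠ x ⊠ y) ≫ rightDefect f = (n ⊠ t ⊠ (x ⊠ y) ≫ μ[A]) ≫ f -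
      ((x ⊠ (n ⊠ t ⊠ y) ≫ f) ≫ outerLeft S A + ((n ⊠ t ⊠ x) ≫ f ⊠ y) ≫ outerRight S A) := by
  simp only [rightDefect, Preadditive.comp_add, Preadditive.comp_sub, ← Category.assoc,
    tens_whiskerLeft, tens_whiskerRight, tens_associator_hom, tens_associator_inv,
    tens_braiding_hom]

/-- The defect is a derivation in the first variable, because inner and outer actions commute. For a
generator there, the bracket is `extendRight f`, a right derivation by construction, so the defect
vanishes. -/
lemma isRightDerivation_extend : IsRightDerivation S (extend f) := by
  have hd : IsDerivation (innerLeft S (T M)) (innerRight S (T M))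
      (exchange S (T M) (S ⊗ (T M ⊗ T M)) ≫ rightDefect (extend f)) := by
    refine IsDerivation.of_detecting ((Detecting.all S).tens ((Detecting.all S).tens
      ((Detecting.all (T M)).tens (Detecting.all (T M))))) ?_
    rintro G _ _ _ a b ⟨s, _, -, ⟨t, _, -, ⟨x, y, -, -, rfl⟩, rfl⟩, rfl⟩
    simp only [← Category.assoc, tens_exchange, tens_rightDefect,
      (isLeftDerivation_extend f).tens, tens_add, add_tens, tens_sub, sub_tens,
      Preadditive.add_comp, Preadditive.sub_comp, tens_innerLeft_outerLeft,
      tens_innerLeft_outerRight, tens_innerRight_outerLeft, tens_innerRight_outerRight]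
    abel
  have hz : exchange S (T M) (S ⊗ (T M ⊗ T M)) ≫ rightDefect (extend f) = 0 := by
    refine hd.eq_zero (isBimodule_inner S _).toIsUnitalPair ?_
    refine (((Detecting.all S).tens ((Detecting.all S).tens
      ((Detecting.all (T M)).tens (Detecting.all (T M))))).tens (Detecting.all M)).hom_ext ?_
    rintro G _ _ _ ⟨_, m, ⟨s, _, -, ⟨t, _, -, ⟨x, y, -, -, rfl⟩, rfl⟩, rfl⟩, -, rfl⟩
    have h₁ (n : G ⟶ S ⊗ T M) : ((s ⊠ m ≫ T.gen M) ⊠ n) ≫ extend f =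
        ((s ⊠ m) ⊠ n) ≫ extendRight f := by
      rw [← gen_whiskerRight_extend, ← Category.assoc, tens_whiskerRight, tens_whiskerLeft]
    have h₂ := isDerivation_extendRight f G ((s ⊠ m) ⊠ t) x y
    simp only [← Category.assoc, tens_associator_hom] at h₂
    simp only [← Category.assoc, tens_whiskerLeft, tens_exchange, tens_rightDefect, h₁, h₂,
      sub_self, comp_zero]
  have hz' : rightDefect (extend f) = 0 := by
    rw [← Category.id_comp (rightDefect _), ← exchange_exchange, Category.assoc, hz, comp_zero]
  refine IsDerivation.of_detecting ((Detecting.all (S ⊗ T M)).tens (Detecting.all S)) ?_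
  rintro G _ _ _ a b ⟨n, t, -, -, rfl⟩
  have := whisker_eq (n ⊠ t ⊠ a ⊠ b) hz'
  rw [tens_rightDefect, comp_zero, sub_eq_zero] at this
  simpa only [← Category.assoc, tens_associator_hom] using this

variable {f}

/-- Two double brackets on a free monoid with the left and the right derivation property that agree
on generators are equal. -/
lemma doubleBracket_ext {g h : DoubleBracket S (T M)} (hg : IsLeftDerivation S g)
    (hg' : IsRightDerivation S g) (hh : IsLeftDerivation S h) (hh' : IsRightDerivation S h)
    (hgen : (S ◁ T.gen M ⊗ₘ S ◁ T.gen M) ≫ g = (S ◁ T.gen M ⊗ₘ S ◁ T.gen M) ≫ h) : g = h := by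
  rw [← sub_eq_zero]
  refine biderivation_eq_zero (isBimodule_inner S _).toIsUnitalPair
    (isBimodule_outer S _).toIsUnitalPair ?_ ?_ ?_
  · rw [Preadditive.comp_sub]
    exact (isLeftDerivation_iff.1 hg).sub (isLeftDerivation_iff.1 hh)
  · rw [Preadditive.comp_sub]
    exact IsDerivation.sub hg' hh'
  · rw [Preadditive.comp_sub, hgen, sub_self]

/-- The bracket and the negative of its swap are both derivations in each variable, and they agree
on generators by antisymmetry of `f`. -/
lemma isAntisymmetric_extend (hf : IsAntisymmetric S f) : IsAntisymmetric S (extend f) := by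
  have hl := (isRightDerivation_extend f).swap
  have hr := (isLeftDerivation_extend f).swap
  refine doubleBracket_ext (isLeftDerivation_extend f) (isRightDerivation_extend f) ?_ ?_ ?_
  · rw [isLeftDerivation_iff, Preadditive.comp_neg]
    exact (isLeftDerivation_iff.1 hl).neg
  · rw [IsRightDerivation, Preadditive.comp_neg]
    exact IsDerivation.neg hr
  · have h := isBracketHom_extend f
    unfold IsBracketHom at h
    rw [Preadditive.comp_neg, BraidedCategory.braiding_naturality_assoc, reassoc_of% h,
      swapOut_naturality, h]
    unfold IsAntisymmetric at hf
    nth_rw 1 [hf]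
    simp

/-- Antisymmetry supplies the right derivation property, after which the values on generators
decide. -/
lemma eq_extend {g : DoubleBracket S (T M)} (ha : IsAntisymmetric S g)
    (hl : IsLeftDerivation S g) (hg : IsBracketHom S f g (T.gen M)) : g = extend f :=
  doubleBracket_ext hl (hl.isRightDerivation ha) (isLeftDerivation_extend f)
    (isRightDerivation_extend f) (hg.trans (isBracketHom_extend f).symm)

/-- Both composites are biderivations on `T(M)` with values in `ΣT(M') ⊗ T(M')`, where `T(M)` acts
through `T(φ)`; they agree on generators. -/
lemma isBracketHom_map {M' : C} {g : DoubleBracket S M'} {φ : M ⟶ M'}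
    (hφ : IsBracketHom S f g φ) : IsBracketHom S (extend f) (extend g) (T.map φ) := by
  have hl := (isLeftDerivation_iff.1 (isLeftDerivation_extend f)).comp
    (innerLeft_naturality S (T.map φ)) (innerRight_naturality S (T.map φ))
  have hr := IsDerivation.comp (isRightDerivation_extend f)
    (outerLeft_naturality S (T.map φ)) (outerRight_naturality S (T.map φ))
  have hl' := ((isLeftDerivation_iff.1 (isLeftDerivation_extend g)).pullback
    (T.map φ)).whiskerRight_comp (S ◁ S ◁ T.map φ)
  have hr' := (IsDerivation.pullback (isRightDerivation_extend g)
    (T.map φ)).whiskerRight_comp ((S ◁ T.map φ) ▷ S)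
  have el : (S ◁ S ◁ T.map φ) ▷ T M ≫ (S ⊗ S ⊗ T M') ◁ T.map φ ≫
      exchange S (T M') (S ⊗ T M') ≫ extend g =
      exchange S (T M) (S ⊗ T M) ≫ (S ◁ T.map φ ⊗ₘ S ◁ T.map φ) ≫ extend g := by
    refine (detecting_tens₃ S (S ⊗ T M) (T M)).hom_ext ?_
    rintro G _ _ _ ⟨s, n, a, rfl⟩
    simp only [← Category.assoc, tens_whiskerLeft, tens_whiskerRight, tens_exchange,
      tens_tensorHom]
  have er : (S ◁ T.map φ) ▷ S ▷ T M ≫ ((S ⊗ T M') ⊗ S) ◁ T.map φ ≫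
      (α_ (S ⊗ T M') S (T M')).hom ≫ extend g =
      (α_ (S ⊗ T M) S (T M)).hom ≫ (S ◁ T.map φ ⊗ₘ S ◁ T.map φ) ≫ extend g := by
    simp [MonoidalCategory.tensorHom_def]
  rw [el] at hl'
  rw [er] at hr'
  unfold IsBracketHom
  rw [← sub_eq_zero]
  refine biderivation_eq_zero ((isBimodule_inner S _).toIsUnitalPair.pullback (T.map φ))
    ((isBimodule_outer S _).toIsUnitalPair.pullback (T.map φ)) ?_ ?_ ?_
  · rw [Preadditive.comp_sub, ← Category.assoc _ (extend f)]
    exact hl'.sub hl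
  · rw [Preadditive.comp_sub, ← Category.assoc _ (extend f)]
    exact hr'.sub hr
  · have h₁ := (hφ.comp (isBracketHom_extend g))
    have h₂ := isBracketHom_extend f
    unfold IsBracketHom at h₁ h₂
    rw [Preadditive.comp_sub, sub_eq_zero, reassoc_of% h₂, tensorHom_comp_tensorHom,
      tensorHom_comp_tensorHom_assoc, ← MonoidalCategory.whiskerLeft_comp, T.gen_map, h₁]

lemma IsRightDerivation.comp_unit {g : DoubleBracket S (T M)} (hg : IsRightDerivation S g) {X : C}
    (φ : X ⟶ T M) : (S ◁ φ ⊗ₘ S ◁ T.unit M) ≫ g = 0 := by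
  change (_ ⊗ₘ S ◁ η[T M]) ≫ g = 0
  refine ((Detecting.all (S ⊗ X)).tens ((Detecting.all S).tens Detecting.unit)).hom_ext ?_
  rintro G _ _ _ ⟨n, _, -, ⟨t, _, -, rfl, rfl⟩, rfl⟩
  have := hg.one (isBimodule_outer S _).toIsUnitalPair (n ≫ S ◁ φ ⊠ t)
  simpa only [← Category.assoc, tens_associator_hom, tens_tensorHom, tens_whiskerLeft,
    comp_zero] using this

lemma isQuadratic_extend : IsQuadratic S (extend f) where
  unit_unit := (isRightDerivation_extend f).comp_unit _
  gen_unit := (isRightDerivation_extend f).comp_unit _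
  gen_gen := ⟨f, isBracketHom_extend f⟩

end Extension

/-! ### The double jacobiator is a derivation -/

section Invertible

variable {C : Type u} [Category.{v} C] [MonoidalCategory C] [BraidedCategory C]

/-- By naturality, conjugating `S' ◁ S ◁ k` with `e` recovers `k`. -/
lemma whiskerLeft_injective_of_iso {S S' : C} (e : S' ⊗ S ≅ 𝟙_ C) {X Y : C} {g h : X ⟶ Y}
    (hgh : S ◁ g = S ◁ h) : g = h := by
  have key (k : X ⟶ Y) : k = (λ_ X).inv ≫ e.inv ▷ X ≫ (α_ S' S X).hom ≫ S' ◁ S ◁ k ≫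
      (α_ S' S Y).inv ≫ e.hom ▷ Y ≫ (λ_ Y).hom := by
    rw [← associator_naturality_right_assoc, Iso.hom_inv_id_assoc, whisker_exchange_assoc]
    simp
  rw [key g, key h, hgh]

/-- Tensoring with an invertible object is full. -/
lemma exists_eq_whiskerLeft_of_iso {S S' : C} (e : S' ⊗ S ≅ 𝟙_ C) {X Y : C}
    (g : S ⊗ X ⟶ S ⊗ Y) : ∃ h : X ⟶ Y, g = S ◁ h := by
  -- No triangle identity is available for `e`, so `g = S ◁ h` is not computed directly. It is
  -- tested after applying `S' ◁`, which is faithful because `S` is also an inverse of `S'`.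
  refine ⟨(λ_ X).inv ≫ e.inv ▷ X ≫ (α_ S' S X).hom ≫ S' ◁ g ≫
      (α_ S' S Y).inv ≫ e.hom ▷ Y ≫ (λ_ Y).hom,
    whiskerLeft_injective_of_iso (β_ S S' ≪≫ e) ?_⟩
  set h := (λ_ X).inv ≫ e.inv ▷ X ≫ (α_ S' S X).hom ≫ S' ◁ g ≫
      (α_ S' S Y).inv ≫ e.hom ▷ Y ≫ (λ_ Y).hom with hh
  have h₁ : S' ◁ S ◁ h = (α_ S' S X).inv ≫ e.hom ▷ X ≫ (λ_ X).hom ≫ h ≫ (λ_ Y).inv ≫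
      e.inv ▷ Y ≫ (α_ S' S Y).hom := by
    rw [leftUnitor_inv_naturality_assoc, whisker_exchange_assoc]
    simp
  rw [h₁, hh]
  simp

end Invertible

/-! ### Nested brackets, their cross terms and the cancellation. -/

section Jacobiator

variable {C : Type u} [Category.{v} C] [MonoidalCategory C] [SymmetricCategory C]
variable (S A : C)

/-- The reassociation `(ΣA ⊗ A) ⊗ A ⟶ Σ(A ⊗ A ⊗ A)`. -/
def flat : ((S ⊗ A) ⊗ A) ⊗ A ⟶ S ⊗ (A ⊗ (A ⊗ A)) :=
  (α_ (S ⊗ A) A A).hom ≫ (α_ S A (A ⊗ A)).hom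

/-- The reassociation `(ΣA ⊗ A) ⊗ A ⟶ Σ(A ⊗ A ⊗ A)`, followed by `(x, y, z) ↦ (y, z, x)`. -/
def flatLeft : ((S ⊗ A) ⊗ A) ⊗ A ⟶ S ⊗ (A ⊗ (A ⊗ A)) := flat S A ≫ S ◁ rotLeft A

/-- The reassociation `(ΣA ⊗ A) ⊗ A ⟶ Σ(A ⊗ A ⊗ A)`, followed by `(x, y, z) ↦ (z, x, y)`. -/
def flatRight : ((S ⊗ A) ⊗ A) ⊗ A ⟶ S ⊗ (A ⊗ (A ⊗ A)) := flat S A ≫ S ◁ rotRight A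

variable {S A} in
/-- The application of `g` to the first two of three factors, followed by a rearrangement. -/
def nest (F : ((S ⊗ A) ⊗ A) ⊗ A ⟶ S ⊗ (A ⊗ (A ⊗ A))) (g : DoubleBracket S A) :
    (S ⊗ A) ⊗ ((S ⊗ A) ⊗ A) ⟶ S ⊗ (A ⊗ (A ⊗ A)) :=
  (α_ (S ⊗ A) (S ⊗ A) A).inv ≫ g ▷ A ≫ F

variable [MonObj A]

/-- The outer left action on `Σ(A ⊗ A ⊗ A)`. -/
def tripleLeft : A ⊗ (S ⊗ (A ⊗ (A ⊗ A))) ⟶ S ⊗ (A ⊗ (A ⊗ A)) :=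
  (α_ _ _ _).inv ≫ (β_ A S).hom ▷ _ ≫ (α_ _ _ _).hom ≫ S ◁ ((α_ _ _ _).inv ≫ μ[A] ▷ (A ⊗ A))

/-- The outer right action on `Σ(A ⊗ A ⊗ A)`. -/
def tripleRight : (S ⊗ (A ⊗ (A ⊗ A))) ⊗ A ⟶ S ⊗ (A ⊗ (A ⊗ A)) :=
  (α_ _ _ _).hom ≫ S ◁ ((α_ _ _ _).hom ≫ A ◁ ((α_ _ _ _).hom ≫ A ◁ μ[A]))

/-- The multiplication of the two middle factors, `(p ⊗ q) ⊗ (x ⊗ y) ↦ p ⊗ qx ⊗ y`. -/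
def mulMiddle : (A ⊗ A) ⊗ (A ⊗ A) ⟶ A ⊗ (A ⊗ A) :=
  (α_ _ _ _).hom ≫ A ◁ ((α_ _ _ _).inv ≫ μ[A] ▷ A)

/-- `(p ⊗ q) ⊗ (Σx ⊗ y) ↦ Σ(p ⊗ qx ⊗ y)`. -/
def joinLeft : (A ⊗ A) ⊗ ((S ⊗ A) ⊗ A) ⟶ S ⊗ (A ⊗ (A ⊗ A)) :=
  (A ⊗ A) ◁ (α_ S A A).hom ≫ (α_ _ _ _).inv ≫ (β_ _ S).hom ▷ _ ≫ (α_ _ _ _).hom ≫ S ◁ mulMiddle A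

/-- `(Σx ⊗ y) ⊗ (p ⊗ q) ↦ Σ(y ⊗ xp ⊗ q)`. -/
def joinRight [Preadditive C] : ((S ⊗ A) ⊗ A) ⊗ (A ⊗ A) ⟶ S ⊗ (A ⊗ (A ⊗ A)) :=
  (swapOut S A ≫ (α_ S A A).hom) ▷ (A ⊗ A) ≫ (α_ _ _ _).hom ≫ S ◁ mulMiddle A

section Pure

variable {S A} {G : C} [ComonObj G]

omit [MonObj A] in
lemma tens_rotLeft [IsCommComonObj G] (x y z : G ⟶ A) :
    (x ⊠ y ⊠ z) ≫ rotLeft A = y ⊠ z ⊠ x := by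
  simp only [rotLeft, ← Category.assoc, tens_braiding_hom, tens_associator_hom]

omit [MonObj A] in
lemma tens_rotRight [IsCommComonObj G] (x y z : G ⟶ A) :
    (x ⊠ y ⊠ z) ≫ rotRight A = z ⊠ x ⊠ y := by
  simp only [rotRight, ← Category.assoc, tens_braiding_hom, tens_associator_inv]

omit [SymmetricCategory C] [MonObj A] in
lemma tens_flat (s : G ⟶ S) (x y z : G ⟶ A) :
    (((s ⊠ x) ⊠ y) ⊠ z) ≫ flat S A = s ⊠ x ⊠ y ⊠ z := by
  simp only [flat, ← Category.assoc, tens_associator_hom]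

omit [SymmetricCategory C] [MonObj A] in
lemma tens_nest (F : ((S ⊗ A) ⊗ A) ⊗ A ⟶ S ⊗ (A ⊗ (A ⊗ A))) (g : DoubleBracket S A)
    (m n : G ⟶ S ⊗ A) (y : G ⟶ A) : (m ⊠ n ⊠ y) ≫ nest F g = ((m ⊠ n) ≫ g ⊠ y) ≫ F := by
  simp only [nest, ← Category.assoc, tens_associator_inv, tens_whiskerRight]

omit [SymmetricCategory C] in
lemma tens_tripleRight (s : G ⟶ S) (b x y z : G ⟶ A) :
    ((s ⊠ x ⊠ y ⊠ z) ⊠ b) ≫ tripleRight S A = s ⊠ x ⊠ y ⊠ (z ⊠ b) ≫ μ[A] := by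
  simp only [tripleRight, ← Category.assoc, tens_associator_hom, tens_whiskerLeft]

omit [SymmetricCategory C] in
lemma tens_mulMiddle (p q x y : G ⟶ A) :
    ((p ⊠ q) ⊠ x ⊠ y) ≫ mulMiddle A = p ⊠ (q ⊠ x) ≫ μ[A] ⊠ y := by
  simp only [mulMiddle, ← Category.assoc, tens_associator_hom, tens_associator_inv,
    tens_whiskerLeft, tens_whiskerRight]

variable [IsCommComonObj G]

lemma tens_tripleLeft (s : G ⟶ S) (a x y z : G ⟶ A) :
    (a ⊠ s ⊠ x ⊠ y ⊠ z) ≫ tripleLeft S A = s ⊠ (a ⊠ x) ≫ μ[A] ⊠ y ⊠ z := by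
  simp only [tripleLeft, ← Category.assoc, tens_associator_hom, tens_associator_inv,
    tens_whiskerLeft, tens_whiskerRight, tens_braiding_hom]

lemma tens_joinLeft (s : G ⟶ S) (w z : G ⟶ A ⊗ A) :
    (w ⊠ (s ⊠ z) ≫ (α_ S A A).inv) ≫ joinLeft S A = s ⊠ (w ⊠ z) ≫ mulMiddle A := by
  have h : ((s ⊠ z) ≫ (α_ S A A).inv) ≫ (α_ S A A).hom = s ⊠ z := by simp
  simp only [joinLeft, ← Category.assoc, tens_whiskerLeft, h, tens_associator_hom,
    tens_associator_inv, tens_whiskerRight, tens_braiding_hom]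

lemma tens_joinLeft_pure (s : G ⟶ S) (w : G ⟶ A ⊗ A) (x y : G ⟶ A) :
    (w ⊠ (s ⊠ x) ⊠ y) ≫ joinLeft S A = s ⊠ (w ⊠ x ⊠ y) ≫ mulMiddle A := by
  rw [← tens_associator_inv, tens_joinLeft]

variable [Preadditive C]

omit [MonObj A] [ComonObj G] [IsCommComonObj G] in
lemma swapOut_swapOut : swapOut S A ≫ swapOut S A = 𝟙 _ := by
  simp [swapOut, ← MonoidalCategory.whiskerLeft_comp_assoc]

lemma tens_joinRight (s : G ⟶ S) (w z : G ⟶ A ⊗ A) :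
    ((s ⊠ w) ≫ (α_ S A A).inv ≫ swapOut S A ⊠ z) ≫ joinRight S A =
      s ⊠ (w ⊠ z) ≫ mulMiddle A := by
  have h : (((s ⊠ w) ≫ (α_ S A A).inv ≫ swapOut S A) ≫ swapOut S A) ≫ (α_ S A A).hom = s ⊠ w := by
    simp [reassoc_of% swapOut_swapOut (S := S) (A := A)]
  simp only [joinRight, ← Category.assoc, tens_whiskerRight] at h ⊢
  rw [h, tens_associator_hom, tens_whiskerLeft]

lemma tens_joinRight_pure (s : G ⟶ S) (z : G ⟶ A ⊗ A) (x y : G ⟶ A) :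
    (((s ⊠ x) ⊠ y) ⊠ z) ≫ joinRight S A = s ⊠ ((y ⊠ x) ⊠ z) ≫ mulMiddle A := by
  rw [← tens_joinRight, ← Category.assoc, tens_associator_inv, tens_swapOut]

omit [MonObj A] in
lemma tens_flatLeft (s : G ⟶ S) (x y z : G ⟶ A) :
    (((s ⊠ x) ⊠ y) ⊠ z) ≫ flatLeft S A = s ⊠ y ⊠ z ⊠ x := by
  simp only [flatLeft, flat, ← Category.assoc, tens_associator_hom, tens_whiskerLeft, tens_rotLeft]

omit [MonObj A] in
lemma tens_flatRight (s : G ⟶ S) (x y z : G ⟶ A) :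
    (((s ⊠ x) ⊠ y) ⊠ z) ≫ flatRight S A = s ⊠ z ⊠ x ⊠ y := by
  simp only [flatRight, flat, ← Category.assoc, tens_associator_hom, tens_whiskerLeft,
    tens_rotRight]

end Pure

variable [Preadditive C] [HasBinaryBiproducts C] [MonoidalPreadditive C]

section Flat

variable {S A}
variable {G : C} [ComonObj G] [IsCommComonObj G] (h : G ⟶ (S ⊗ A) ⊗ A)

/-- This lemma and the next five share one principle: the rearrangement carries the factor that is
multiplied to the first or last place of `Σ(A ⊗ A ⊗ A)`, where the action is the outer one. -/
lemma tens_outerLeft_flat (c y : G ⟶ A) : ((c ⊠ h) ≫ outerLeft S A ⊠ y) ≫ flat S A =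
    (c ⊠ (h ⊠ y) ≫ flat S A) ≫ tripleLeft S A := by
  have e : outerLeft S A ▷ A ≫ flat S A =
      (α_ _ _ _).hom ≫ A ◁ flat S A ≫ tripleLeft S A := by
    refine (((Detecting.all A).tens (detecting_tens₃ S A A)).tens (Detecting.all A)).hom_ext ?_
    rintro G _ _ _ ⟨_, y, ⟨c, _, -, ⟨s, x, z, rfl⟩, rfl⟩, -, rfl⟩
    simp only [← Category.assoc, tens_whiskerLeft, tens_whiskerRight, tens_associator_hom,
      tens_outerLeft, tens_flat, tens_tripleLeft]
  simpa only [← Category.assoc, tens_whiskerLeft, tens_whiskerRight, tens_associator_hom] using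
    whisker_eq ((c ⊠ h) ⊠ y) e

lemma tens_mul_flat (y c : G ⟶ A) : (h ⊠ (y ⊠ c) ≫ μ[A]) ≫ flat S A =
    ((h ⊠ y) ≫ flat S A ⊠ c) ≫ tripleRight S A := by
  have e : _ ◁ μ[A] ≫ flat S A = (α_ _ _ _).inv ≫ flat S A ▷ A ≫ tripleRight S A := by
    refine ((detecting_tens₃ S A A).tens ((Detecting.all A).tens (Detecting.all A))).hom_ext ?_
    rintro G _ _ _ ⟨_, _, ⟨s, x, z, rfl⟩, ⟨y, c, -, -, rfl⟩, rfl⟩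
    simp only [← Category.assoc, tens_whiskerLeft, tens_whiskerRight, tens_associator_inv,
      tens_flat, tens_tripleRight]
  simpa only [← Category.assoc, tens_whiskerLeft, tens_whiskerRight, tens_associator_inv] using
    whisker_eq (h ⊠ y ⊠ c) e

lemma tens_innerLeft_flatLeft (c y : G ⟶ A) : ((c ⊠ h) ≫ innerLeft S A ⊠ y) ≫ flatLeft S A =
    (c ⊠ (h ⊠ y) ≫ flatLeft S A) ≫ tripleLeft S A := by
  have e : innerLeft S A ▷ A ≫ flatLeft S A =
      (α_ _ _ _).hom ≫ A ◁ flatLeft S A ≫ tripleLeft S A := by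
    refine (((Detecting.all A).tens (detecting_tens₃ S A A)).tens (Detecting.all A)).hom_ext ?_
    rintro G _ _ _ ⟨_, y, ⟨c, _, -, ⟨s, x, z, rfl⟩, rfl⟩, -, rfl⟩
    simp only [← Category.assoc, tens_whiskerLeft, tens_whiskerRight, tens_associator_hom,
      tens_innerLeft, tens_flatLeft, tens_tripleLeft]
  simpa only [← Category.assoc, tens_whiskerLeft, tens_whiskerRight, tens_associator_hom] using
    whisker_eq ((c ⊠ h) ⊠ y) e

lemma tens_innerRight_flatLeft (c y : G ⟶ A) : ((h ⊠ c) ≫ innerRight S A ⊠ y) ≫ flatLeft S A =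
    ((h ⊠ y) ≫ flatLeft S A ⊠ c) ≫ tripleRight S A := by
  have e : innerRight S A ▷ A ≫ flatLeft S A = (α_ _ _ _).hom ≫ _ ◁ (β_ A A).hom ≫
      (α_ _ _ _).inv ≫ flatLeft S A ▷ A ≫ tripleRight S A := by
    refine (((detecting_tens₃ S A A).tens (Detecting.all A)).tens (Detecting.all A)).hom_ext ?_
    rintro G _ _ _ ⟨_, y, ⟨_, c, ⟨s, x, z, rfl⟩, -, rfl⟩, -, rfl⟩
    simp only [← Category.assoc, tens_whiskerLeft, tens_whiskerRight, tens_associator_hom,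
      tens_associator_inv, tens_braiding_hom, tens_innerRight, tens_flatLeft, tens_tripleRight]
  simpa only [← Category.assoc, tens_whiskerLeft, tens_whiskerRight, tens_associator_hom,
    tens_associator_inv, tens_braiding_hom] using whisker_eq ((h ⊠ c) ⊠ y) e

lemma tens_mul_flatRight (c y : G ⟶ A) : (h ⊠ (c ⊠ y) ≫ μ[A]) ≫ flatRight S A =
    (c ⊠ (h ⊠ y) ≫ flatRight S A) ≫ tripleLeft S A := by
  have e : _ ◁ μ[A] ≫ flatRight S A = (α_ _ _ _).inv ≫ (β_ _ A).hom ▷ A ≫ (α_ _ _ _).hom ≫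
      A ◁ flatRight S A ≫ tripleLeft S A := by
    refine ((detecting_tens₃ S A A).tens ((Detecting.all A).tens (Detecting.all A))).hom_ext ?_
    rintro G _ _ _ ⟨_, _, ⟨s, x, z, rfl⟩, ⟨c, y, -, -, rfl⟩, rfl⟩
    simp only [← Category.assoc, tens_whiskerLeft, tens_whiskerRight, tens_associator_hom,
      tens_associator_inv, tens_braiding_hom, tens_flatRight, tens_tripleLeft]
  simpa only [← Category.assoc, tens_whiskerLeft, tens_whiskerRight, tens_associator_hom,
    tens_associator_inv, tens_braiding_hom] using whisker_eq (h ⊠ c ⊠ y) e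

lemma tens_outerRight_flatRight (c y : G ⟶ A) :
    ((h ⊠ c) ≫ outerRight S A ⊠ y) ≫ flatRight S A =
      ((h ⊠ y) ≫ flatRight S A ⊠ c) ≫ tripleRight S A := by
  have e : outerRight S A ▷ A ≫ flatRight S A = (α_ _ _ _).hom ≫ _ ◁ (β_ A A).hom ≫
      (α_ _ _ _).inv ≫ flatRight S A ▷ A ≫ tripleRight S A := by
    refine (((detecting_tens₃ S A A).tens (Detecting.all A)).tens (Detecting.all A)).hom_ext ?_
    rintro G _ _ _ ⟨_, y, ⟨_, c, ⟨s, x, z, rfl⟩, -, rfl⟩, -, rfl⟩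
    simp only [← Category.assoc, tens_whiskerLeft, tens_whiskerRight, tens_associator_hom,
      tens_associator_inv, tens_braiding_hom, tens_outerRight, tens_flatRight, tens_tripleRight]
  simpa only [← Category.assoc, tens_whiskerLeft, tens_whiskerRight, tens_associator_hom,
    tens_associator_inv, tens_braiding_hom] using whisker_eq ((h ⊠ c) ⊠ y) e

/-- Here, and in the next lemma, the product lands in the middle factor. These are the sources of
the cross terms. -/
lemma tens_outerRight_flat (v : G ⟶ S) (w : G ⟶ A ⊗ A) (x y : G ⟶ A) :
    (((v ⊠ w) ≫ (α_ S A A).inv ⊠ x) ≫ outerRight S A ⊠ y) ≫ flat S A =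
      v ⊠ (w ⊠ x ⊠ y) ≫ mulMiddle A := by
  have e : (α_ S A A).inv ▷ A ▷ A ≫ outerRight S A ▷ A ≫ flat S A =
      (α_ _ _ _).hom ≫ (α_ _ _ _).hom ≫ S ◁ mulMiddle A := by
    refine ((((Detecting.all S).tens ((Detecting.all A).tens (Detecting.all A))).tens
      (Detecting.all A)).tens (Detecting.all A)).hom_ext ?_
    rintro G _ _ _ ⟨_, y, ⟨_, x, ⟨v, _, -, ⟨p, q, -, -, rfl⟩, rfl⟩, -, rfl⟩, -, rfl⟩
    simp only [← Category.assoc, tens_whiskerLeft, tens_whiskerRight, tens_associator_hom,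
      tens_associator_inv, tens_outerRight, tens_flat, tens_mulMiddle]
  simpa only [← Category.assoc, tens_whiskerLeft, tens_whiskerRight, tens_associator_hom] using
    whisker_eq (((v ⊠ w) ⊠ x) ⊠ y) e

lemma tens_outerLeft_flatRight (v : G ⟶ S) (w : G ⟶ A ⊗ A) (x y : G ⟶ A) :
    ((x ⊠ (v ⊠ w) ≫ (α_ S A A).inv) ≫ outerLeft S A ⊠ y) ≫ flatRight S A =
      v ⊠ ((y ⊠ x) ⊠ w) ≫ mulMiddle A := by
  have e : (A ◁ (α_ S A A).inv) ▷ A ≫ outerLeft S A ▷ A ≫ flatRight S A =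
      (β_ _ A).hom ≫ (α_ A A _).inv ≫ (α_ (A ⊗ A) S (A ⊗ A)).inv ≫ (β_ _ S).hom ▷ _ ≫
        (α_ _ _ _).hom ≫ S ◁ mulMiddle A := by
    refine (((Detecting.all A).tens ((Detecting.all S).tens ((Detecting.all A).tens
      (Detecting.all A)))).tens (Detecting.all A)).hom_ext ?_
    rintro G _ _ _ ⟨_, y, ⟨x, _, -, ⟨v, _, -, ⟨p, q, -, -, rfl⟩, rfl⟩, rfl⟩, -, rfl⟩
    simp only [← Category.assoc, tens_whiskerLeft, tens_whiskerRight, tens_associator_hom,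
      tens_associator_inv, tens_braiding_hom, tens_outerLeft, tens_flatRight, tens_mulMiddle]
  simpa only [← Category.assoc, tens_whiskerLeft, tens_whiskerRight, tens_associator_hom,
    tens_associator_inv, tens_braiding_hom] using whisker_eq ((x ⊠ v ⊠ w) ⊠ y) e

end Flat

section Nest

variable {S A} {g : DoubleBracket S A} {G : C} [ComonObj G] [IsCommComonObj G]

/-- The action hits the factor of `k` that the nested bracket leaves untouched, so no Leibniz rule
and no cross term arise. The next lemma is the analogue for the inner left action. -/
lemma tens_outerRight_nest (m : G ⟶ S ⊗ A) (k : G ⟶ (S ⊗ A) ⊗ A) (c : G ⟶ A) :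
    (m ⊠ (k ⊠ c) ≫ outerRight S A) ≫ nest (flat S A) g =
      ((m ⊠ k) ≫ nest (flat S A) g ⊠ c) ≫ tripleRight S A := by
  have e : _ ◁ outerRight S A ≫ nest (flat S A) g =
      (α_ _ _ _).inv ≫ nest (flat S A) g ▷ A ≫ tripleRight S A := by
    refine ((Detecting.all (S ⊗ A)).tens ((detecting_tens₃ S A A).tens
      (Detecting.all A))).hom_ext ?_
    rintro G _ _ _ ⟨m, _, -, ⟨_, c, ⟨v, x, y, rfl⟩, -, rfl⟩, rfl⟩
    simp only [← Category.assoc, tens_whiskerLeft, tens_whiskerRight, tens_associator_inv,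
      tens_outerRight, tens_nest, tens_mul_flat]
  simpa only [← Category.assoc, tens_whiskerLeft, tens_whiskerRight, tens_associator_inv] using
    whisker_eq (m ⊠ k ⊠ c) e

lemma tens_innerLeft_nest (m : G ⟶ S ⊗ A) (k : G ⟶ (S ⊗ A) ⊗ A) (c : G ⟶ A) :
    (m ⊠ (c ⊠ k) ≫ innerLeft S A) ≫ nest (flatRight S A) g =
      (c ⊠ (m ⊠ k) ≫ nest (flatRight S A) g) ≫ tripleLeft S A := by
  have e : _ ◁ innerLeft S A ≫ nest (flatRight S A) g = (α_ _ _ _).inv ≫ (β_ _ A).hom ▷ _ ≫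
      (α_ _ _ _).hom ≫ A ◁ nest (flatRight S A) g ≫ tripleLeft S A := by
    refine ((Detecting.all (S ⊗ A)).tens ((Detecting.all A).tens
      (detecting_tens₃ S A A))).hom_ext ?_
    rintro G _ _ _ ⟨m, _, -, ⟨c, _, -, ⟨v, x, y, rfl⟩, rfl⟩, rfl⟩
    simp only [← Category.assoc, tens_whiskerLeft, tens_whiskerRight, tens_associator_inv,
      tens_associator_hom, tens_braiding_hom, tens_innerLeft, tens_nest, tens_mul_flatRight]
  simpa only [← Category.assoc, tens_whiskerLeft, tens_whiskerRight, tens_associator_inv,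
    tens_associator_hom, tens_braiding_hom] using whisker_eq (m ⊠ c ⊠ k) e

lemma IsLeftDerivation.tens_mul_nest (hg : IsLeftDerivation S g) (u : G ⟶ S) (a b : G ⟶ A)
    (k : G ⟶ (S ⊗ A) ⊗ A) : ((u ⊠ (a ⊠ b) ≫ μ[A]) ⊠ k) ≫ nest (flatLeft S A) g =
      (a ⊠ ((u ⊠ b) ⊠ k) ≫ nest (flatLeft S A) g) ≫ tripleLeft S A +
      (((u ⊠ a) ⊠ k) ≫ nest (flatLeft S A) g ⊠ b) ≫ tripleRight S A := by
  have e : (S ◁ μ[A]) ▷ _ ≫ nest (flatLeft S A) g =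
      ((α_ S A A).inv ≫ (β_ S A).hom ▷ A ≫ (α_ A S A).hom) ▷ _ ≫ (α_ _ _ _).hom ≫
        A ◁ nest (flatLeft S A) g ≫ tripleLeft S A +
      (α_ S A A).inv ▷ _ ≫ (α_ _ _ _).hom ≫ _ ◁ (β_ A _).hom ≫ (α_ _ _ _).inv ≫
        nest (flatLeft S A) g ▷ A ≫ tripleRight S A := by
    refine (((Detecting.all S).tens ((Detecting.all A).tens (Detecting.all A))).tens
      (detecting_tens₃ S A A)).hom_ext ?_
    rintro G _ _ _ ⟨_, _, ⟨u, _, -, ⟨a, b, -, -, rfl⟩, rfl⟩, ⟨v, x, y, rfl⟩, rfl⟩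
    simp only [Preadditive.comp_add, ← Category.assoc, tens_whiskerLeft, tens_whiskerRight,
      tens_associator_inv, tens_associator_hom, tens_braiding_hom, tens_nest, hg.tens, add_tens,
      Preadditive.add_comp, tens_innerLeft_flatLeft, tens_innerRight_flatLeft]
  simpa only [Preadditive.comp_add, ← Category.assoc, tens_whiskerLeft, tens_whiskerRight,
    tens_associator_inv, tens_associator_hom, tens_braiding_hom] using
    whisker_eq ((u ⊠ a ⊠ b) ⊠ k) e

variable (S A) in
/-- The isomorphism `ΣA ⊗ ΣA ≅ Σ(ΣA ⊗ A)` that moves the second `Σ` to the front. -/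
def pullIso : (S ⊗ A) ⊗ (S ⊗ A) ≅ S ⊗ (S ⊗ (A ⊗ A)) :=
  (α_ (S ⊗ A) S A).symm ≪≫ whiskerRightIso (β_ (S ⊗ A) S) A ≪≫ α_ S (S ⊗ A) A ≪≫
    whiskerLeftIso S (α_ S A A)

/-- A double bracket that leaves its second `Σ` alone. -/
def IsLift (g₀ : S ⊗ (A ⊗ A) ⟶ A ⊗ A) (g : DoubleBracket S A) : Prop :=
  g = (pullIso S A).hom ≫ S ◁ g₀ ≫ (α_ S A A).inv

/-- The invertibility of `Σ` enters the argument here, through fullness of `Σ ⊗ -`. -/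
lemma exists_isLift {S' : C} (e : S' ⊗ S ≅ 𝟙_ C) (g : DoubleBracket S A) :
    ∃ g₀, IsLift g₀ g := by
  obtain ⟨g₀, h⟩ := exists_eq_whiskerLeft_of_iso e ((pullIso S A).inv ≫ g ≫ (α_ S A A).hom)
  exact ⟨g₀, by rw [IsLift, ← h]; simp⟩

variable {g₀ : S ⊗ (A ⊗ A) ⟶ A ⊗ A}

lemma IsLift.tens (h : IsLift g₀ g) (s t : G ⟶ S) (a b : G ⟶ A) :
    ((s ⊠ a) ⊠ t ⊠ b) ≫ g = (t ⊠ (s ⊠ a ⊠ b) ≫ g₀) ≫ (α_ S A A).inv := by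
  unfold IsLift at h
  rw [h]
  simp only [pullIso, Iso.trans_hom, Iso.symm_hom, whiskerRightIso_hom, whiskerLeftIso_hom,
    ← Category.assoc, tens_whiskerLeft, tens_whiskerRight, tens_associator_inv, tens_associator_hom,
    tens_braiding_hom]

/-- The Leibniz rule brackets `sa` with `c` carrying the `Σ` that belongs to `k`. Because the lift
leaves that `Σ` alone, the extra term separates into `g₀(s, a, c)` and an intact `k`. -/
lemma IsLift.tens_outerLeft_nest (h : IsLift g₀ g) (hg : IsRightDerivation S g) (s : G ⟶ S)
    (a c : G ⟶ A) (k : G ⟶ (S ⊗ A) ⊗ A) :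
    ((s ⊠ a) ⊠ (c ⊠ k) ≫ outerLeft S A) ≫ nest (flat S A) g =
      (c ⊠ ((s ⊠ a) ⊠ k) ≫ nest (flat S A) g) ≫ tripleLeft S A +
      ((s ⊠ a ⊠ c) ≫ g₀ ⊠ k) ≫ joinLeft S A := by
  have e : _ ◁ outerLeft S A ≫ nest (flat S A) g = (α_ _ _ _).inv ≫ (β_ _ A).hom ▷ _ ≫
      (α_ _ _ _).hom ≫ A ◁ nest (flat S A) g ≫ tripleLeft S A +
      (α_ (S ⊗ A) A _).inv ≫ (α_ S A A).hom ▷ _ ≫ g₀ ▷ _ ≫ joinLeft S A := by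
    refine (((Detecting.all S).tens (Detecting.all A)).tens
      ((Detecting.all A).tens (detecting_tens₃ S A A))).hom_ext ?_
    rintro G _ _ _ ⟨_, _, ⟨s, a, -, -, rfl⟩, ⟨c, _, -, ⟨v, x, y, rfl⟩, rfl⟩, rfl⟩
    simp only [Preadditive.comp_add, ← Category.assoc, tens_whiskerLeft, tens_whiskerRight,
      tens_associator_inv, tens_associator_hom, tens_braiding_hom, tens_outerLeft, tens_nest,
      hg.tens, add_tens, Preadditive.add_comp, tens_outerLeft_flat, tens_joinLeft_pure]
    rw [h.tens s v a c, tens_outerRight_flat]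
  simpa only [Preadditive.comp_add, ← Category.assoc, tens_whiskerLeft, tens_whiskerRight,
    tens_associator_inv, tens_associator_hom, tens_braiding_hom] using
    whisker_eq ((s ⊠ a) ⊠ c ⊠ k) e

/-- As for the outer left action, but the other summand of the Leibniz rule becomes the cross term.
-/
lemma IsLift.tens_innerRight_nest (h : IsLift g₀ g) (hg : IsRightDerivation S g) (t : G ⟶ S)
    (b c : G ⟶ A) (k : G ⟶ (S ⊗ A) ⊗ A) :
    ((t ⊠ b) ⊠ (k ⊠ c) ≫ innerRight S A) ≫ nest (flatRight S A) g =
      (((t ⊠ b) ⊠ k) ≫ nest (flatRight S A) g ⊠ c) ≫ tripleRight S A +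
      (k ⊠ (t ⊠ b ⊠ c) ≫ g₀) ≫ joinRight S A := by
  have e : _ ◁ innerRight S A ≫ nest (flatRight S A) g =
      (α_ _ _ _).inv ≫ nest (flatRight S A) g ▷ A ≫ tripleRight S A +
      (α_ (S ⊗ A) _ A).inv ≫ (β_ _ _).hom ▷ A ≫ (α_ _ (S ⊗ A) A).hom ≫ _ ◁ (α_ S A A).hom ≫
        _ ◁ g₀ ≫ joinRight S A := by
    refine (((Detecting.all S).tens (Detecting.all A)).tens
      ((detecting_tens₃ S A A).tens (Detecting.all A))).hom_ext ?_
    rintro G _ _ _ ⟨_, _, ⟨t, b, -, -, rfl⟩, ⟨_, c, ⟨v, x, y, rfl⟩, -, rfl⟩, rfl⟩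
    simp only [Preadditive.comp_add, ← Category.assoc, tens_whiskerLeft, tens_whiskerRight,
      tens_associator_inv, tens_associator_hom, tens_braiding_hom, tens_innerRight, tens_nest,
      hg.tens, add_tens, Preadditive.add_comp, tens_outerRight_flatRight, tens_joinRight_pure]
    rw [h.tens t v b c, tens_outerLeft_flatRight, add_comm]
  simpa only [Preadditive.comp_add, ← Category.assoc, tens_whiskerLeft, tens_whiskerRight,
    tens_associator_inv, tens_associator_hom, tens_braiding_hom] using
    whisker_eq ((t ⊠ b) ⊠ k ⊠ c) e

omit [MonObj A] in
lemma tens_doubleJacobiator (m n k : G ⟶ S ⊗ A) : (m ⊠ n ⊠ k) ≫ doubleJacobiator S g =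
    (m ⊠ (n ⊠ k) ≫ g) ≫ nest (flat S A) g + (k ⊠ (m ⊠ n) ≫ g) ≫ nest (flatLeft S A) g +
      (n ⊠ (k ⊠ m) ≫ g) ≫ nest (flatRight S A) g := by
  simp only [doubleJacobiator, leftNested, nest, flatLeft, flatRight, flat, tens_rotLeft,
    tens_rotRight, Preadditive.comp_add, ← Category.assoc, tens_whiskerLeft]

/-- The double jacobiator is a derivation in its last variable. -/
lemma IsLift.isDerivation_doubleJacobiator (h : IsLift g₀ g) (ha : IsAntisymmetric S g)
    (hl : IsLeftDerivation S g) : IsDerivation (tripleLeft S A) (tripleRight S A)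
      ((α_ ((S ⊗ A) ⊗ (S ⊗ A)) S A).hom ≫ (α_ (S ⊗ A) (S ⊗ A) (S ⊗ A)).hom ≫
        doubleJacobiator S g) := by
  have hr := hl.isRightDerivation ha
  refine IsDerivation.of_detecting ((((Detecting.all S).tens (Detecting.all A)).tens
    ((Detecting.all S).tens (Detecting.all A))).tens (Detecting.all S)) ?_
  rintro G _ _ _ c d ⟨_, u, ⟨_, _, ⟨s, a, -, -, rfl⟩, ⟨t, b, -, -, rfl⟩, rfl⟩, -, rfl⟩
  -- The two cross terms. After antisymmetry turns `g(uc, sa)` into minus the swap of `g(sa, uc)`,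
  -- both are, up to opposite signs, `u` tensored with the middle product of `g₀(s, a, c)` and
  -- `g₀(t, b, d)`.
  have key : ((s ⊠ a ⊠ c) ≫ g₀ ⊠ ((t ⊠ b) ⊠ u ⊠ d) ≫ g) ≫ joinLeft S A +
      (((u ⊠ c) ⊠ s ⊠ a) ≫ g ⊠ (t ⊠ b ⊠ d) ≫ g₀) ≫ joinRight S A = 0 := by
    rw [ha.tens (u ⊠ c), neg_tens, Preadditive.neg_comp, ← Category.assoc _ g, h.tens, h.tens,
      Category.assoc _ _ (swapOut S A), tens_joinLeft, tens_joinRight, add_neg_cancel]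
  simp only [← Category.assoc, tens_associator_hom, tens_doubleJacobiator, hr.tens, hl.tens,
    tens_add, add_tens, Preadditive.add_comp, hl.tens_mul_nest,
    tens_outerRight_nest, tens_innerLeft_nest,
    h.tens_outerLeft_nest hr, h.tens_innerRight_nest hr]
  rw [← sub_eq_zero, ← key]
  abel

end Nest

end Jacobiator

/-! ### The extended bracket is a double Poisson bracket -/

section Rotation

variable {C : Type u} [Category.{v} C] [MonoidalCategory C] [SymmetricCategory C]
  [Preadditive C] [HasBinaryBiproducts C] [MonoidalPreadditive C]

lemma rotRight_rotRight (X : C) : rotRight X ≫ rotRight X = rotLeft X := by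
  refine ((Detecting.all X).tens ((Detecting.all X).tens (Detecting.all X))).hom_ext ?_
  rintro G _ _ _ ⟨x, _, -, ⟨y, z, -, -, rfl⟩, rfl⟩
  rw [← Category.assoc, tens_rotRight, tens_rotRight, tens_rotLeft]

lemma rotLeft_rotRight (X : C) : rotLeft X ≫ rotRight X = 𝟙 _ := by
  refine ((Detecting.all X).tens ((Detecting.all X).tens (Detecting.all X))).hom_ext ?_
  rintro G _ _ _ ⟨x, _, -, ⟨y, z, -, -, rfl⟩, rfl⟩
  rw [← Category.assoc, tens_rotLeft, tens_rotRight, Category.comp_id]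

lemma rotRight_rotLeft (X : C) : rotRight X ≫ rotLeft X = 𝟙 _ := by
  refine ((Detecting.all X).tens ((Detecting.all X).tens (Detecting.all X))).hom_ext ?_
  rintro G _ _ _ ⟨x, _, -, ⟨y, z, -, -, rfl⟩, rfl⟩
  rw [← Category.assoc, tens_rotRight, tens_rotLeft, Category.comp_id]

variable {S A : C}

/-- The double jacobiator is invariant under cyclic permutations. -/
lemma rotRight_doubleJacobiator (g : DoubleBracket S A) :
    rotRight (S ⊗ A) ≫ doubleJacobiator S g = doubleJacobiator S g ≫ S ◁ rotRight A := by
  simp only [doubleJacobiator, Preadditive.comp_add, Preadditive.add_comp, Category.assoc,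
    ← MonoidalCategory.whiskerLeft_comp, reassoc_of% rotRight_rotRight (S ⊗ A),
    reassoc_of% rotRight_rotLeft (S ⊗ A), rotRight_rotRight, rotLeft_rotRight,
    MonoidalCategory.whiskerLeft_id, Category.comp_id]
  abel

/-- By cyclic invariance any argument can be brought to the last place, the only one in which the
derivation property has been established. -/
lemma rotate_doubleJacobiator {X Y Z : C} {g : DoubleBracket S A} {p : X ⟶ S ⊗ A} {q : Y ⟶ S ⊗ A}
    {r : Z ⟶ S ⊗ A} (h : (p ⊗ₘ (q ⊗ₘ r)) ≫ doubleJacobiator S g = 0) :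
    (r ⊗ₘ (p ⊗ₘ q)) ≫ doubleJacobiator S g = 0 := by
  refine ((Detecting.all Z).tens ((Detecting.all X).tens (Detecting.all Y))).hom_ext ?_
  rintro G _ _ _ ⟨z, _, -, ⟨x, y, -, -, rfl⟩, rfl⟩
  have h₁ := whisker_eq (x ⊠ y ⊠ z) (eq_whisker h (S ◁ rotRight A))
  rw [Category.assoc, ← rotRight_doubleJacobiator] at h₁
  simpa only [← Category.assoc, tens_tensorHom, tens_rotRight, comp_zero, zero_comp] using h₁

variable [MonObj A]

variable (S A) in
lemma isBimodule_triple : IsBimodule (tripleLeft S A) (tripleRight S A) := by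
  refine IsBimodule.of_detecting ((Detecting.all S).tens ((Detecting.all A).tens
    ((Detecting.all A).tens (Detecting.all A)))) ?_ ?_ ?_ ?_ ?_
  · rintro G _ _ _ ⟨s, _, -, ⟨x, _, -, ⟨y, z, -, -, rfl⟩, rfl⟩, rfl⟩
    rw [tens_tripleLeft, tens_one_mul]
  · rintro G _ _ _ ⟨s, _, -, ⟨x, _, -, ⟨y, z, -, -, rfl⟩, rfl⟩, rfl⟩
    rw [tens_tripleRight, tens_mul_one]
  · rintro G _ _ a b _ ⟨s, _, -, ⟨x, _, -, ⟨y, z, -, -, rfl⟩, rfl⟩, rfl⟩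
    simp only [tens_tripleLeft, tens_mul_assoc]
  · rintro G _ _ a b _ ⟨s, _, -, ⟨x, _, -, ⟨y, z, -, -, rfl⟩, rfl⟩, rfl⟩
    simp only [tens_tripleRight, tens_mul_assoc]
  · rintro G _ _ a b _ ⟨s, _, -, ⟨x, _, -, ⟨y, z, -, -, rfl⟩, rfl⟩, rfl⟩
    simp only [tens_tripleRight, tens_tripleLeft]

end Rotation

/-! ### The Jacobi identity on the free monoid, and the equivalence. -/

section Main

variable {C : Type u} [Category.{v} C] [MonoidalCategory C] [SymmetricCategory C]
  [HasTensorAlgebras C] [Preadditive C] [HasBinaryBiproducts C] [MonoidalPreadditive C]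
variable {S S' M : C}

/-- The first two arguments and the last `Σ` are parameters of a derivation on `T(M)` that vanishes
on generators. -/
lemma doubleJacobiator_eq_zero_of_gen {X Y : C} (e : S' ⊗ S ≅ 𝟙_ C) {g : DoubleBracket S (T M)}
    (ha : IsAntisymmetric S g) (hl : IsLeftDerivation S g) {p : X ⟶ S ⊗ T M} {q : Y ⟶ S ⊗ T M}
    (h : (p ⊗ₘ (q ⊗ₘ S ◁ T.gen M)) ≫ doubleJacobiator S g = 0) :
    (p ⊗ₘ (q ⊗ₘ 𝟙 (S ⊗ T M))) ≫ doubleJacobiator S g = 0 := by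
  obtain ⟨g₀, hg₀⟩ := exists_isLift e g
  have h₀ := ((hg₀.isDerivation_doubleJacobiator ha hl).whiskerRight_comp
    ((p ⊗ₘ q) ▷ S)).eq_zero (isBimodule_triple S _).toIsUnitalPair (by
    refine ((((Detecting.all X).tens (Detecting.all Y)).tens (Detecting.all S)).tens
      (Detecting.all M)).hom_ext ?_
    rintro G _ _ _ ⟨_, m, ⟨_, s, ⟨x, y, -, -, rfl⟩, -, rfl⟩, -, rfl⟩
    simpa only [← Category.assoc, tens_tensorHom, tens_whiskerLeft, tens_whiskerRight,
      tens_associator_hom, comp_zero] using whisker_eq (x ⊠ y ⊠ s ⊠ m) h)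
  refine ((Detecting.all X).tens ((Detecting.all Y).tens ((Detecting.all S).tens
    (Detecting.all (T M))))).hom_ext ?_
  rintro G _ _ _ ⟨x, _, -, ⟨y, _, -, ⟨s, m, -, -, rfl⟩, rfl⟩, rfl⟩
  simpa only [← Category.assoc, tens_tensorHom, tens_whiskerLeft, tens_whiskerRight,
    tens_associator_hom, comp_zero, Category.comp_id] using whisker_eq (((x ⊠ y) ⊠ s) ⊠ m) h₀

lemma isDoublePoisson_extend (e : S' ⊗ S ≅ 𝟙_ C) {f : DoubleBracket S M}
    (hf : IsDoubleLie S f) : IsDoublePoisson S (extend f) where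
  antisymm := isAntisymmetric_extend hf.antisymm
  derivation := isLeftDerivation_extend f
  jacobi := by
    have ha := isAntisymmetric_extend hf.antisymm
    have hl := isLeftDerivation_extend f
    have h := (isBracketHom_extend f).doubleJacobiator
    rw [hf.jacobi, zero_comp] at h
    -- From three generators, the last argument is freed and rotated to the front; doing this again
    -- and freeing the remaining one frees all three.
    have h₁ := rotate_doubleJacobiator (doubleJacobiator_eq_zero_of_gen e ha hl h)
    have h₂ := rotate_doubleJacobiator (doubleJacobiator_eq_zero_of_gen e ha hl h₁)
    simpa using doubleJacobiator_eq_zero_of_gen e ha hl h₂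

/-- The extension of a double Lie bracket to a quadratic double Poisson bracket. -/
noncomputable def DLie.extension (e : S' ⊗ S ≅ 𝟙_ C) (L : DLie S) : QuadBracket S L.X where
  bracket := extend L.bracket
  isDoublePoisson := isDoublePoisson_extend e L.isDoubleLie
  isQuadratic := isQuadratic_extend

lemma QuadBracket.restrict_extension (e : S' ⊗ S ≅ 𝟙_ C) (L : DLie S) :
    (L.extension e).restrict = L.bracket := by
  have h := isBracketHom_extend L.bracket
  unfold IsBracketHom at h
  rw [QuadBracket.restrict, DLie.extension, reassoc_of% h, tensorHom_comp_tensorHom,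
    ← MonoidalCategory.whiskerLeft_comp, T.gen_proj]
  simp

/-- Uniqueness of the extension, applied to the given bracket. -/
lemma QuadBracket.extend_restrict (q : QuadBracket S M) : extend q.restrict = q.bracket :=
  (eq_extend q.isDoublePoisson.antisymm q.isDoublePoisson.derivation q.restrict_spec).symm

lemma IsBracketHom.of_eq {C : Type u} [Category.{v} C] [MonoidalCategory C] {S A : C}
    {f g : DoubleBracket S A} (h : f = g) :
    IsBracketHom S f g (𝟙 A) := h ▸ IsBracketHom.id S f

/-- An isomorphism of double Lie algebras with the same underlying object and bracket. -/
def DLie.isoOfEq {X : C} {f g : DoubleBracket S X} (h : f = g) (hf : IsDoubleLie S f)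
    (hg : IsDoubleLie S g) : (⟨X, f, hf⟩ : DLie S) ≅ ⟨X, g, hg⟩ where
  hom := ⟨𝟙 X, IsBracketHom.of_eq h⟩
  inv := ⟨𝟙 X, IsBracketHom.of_eq h.symm⟩
  hom_inv_id := DLie.Hom.ext (Category.id_comp _)
  inv_hom_id := DLie.Hom.ext (Category.id_comp _)

/-- An isomorphism of free double Poisson algebras with the same generators and bracket. -/
noncomputable def DPFreeQuad.isoOfEq {X : C} {q r : QuadBracket S X} (h : q.bracket = r.bracket) :
    (⟨X, q⟩ : DPFreeQuad S) ≅ ⟨X, r⟩ where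
  hom := ⟨𝟙 _, inferInstance, IsBracketHom.of_eq h, 𝟙 X, (T.map_id X).symm⟩
  inv := ⟨𝟙 _, inferInstance, IsBracketHom.of_eq h.symm, 𝟙 X, (T.map_id X).symm⟩
  hom_inv_id := DPFreeQuad.Hom.ext (Category.id_comp _)
  inv_hom_id := DPFreeQuad.Hom.ext (Category.id_comp _)

variable (S) in
/-- The free monoid functor from double Lie algebras. -/
noncomputable abbrev extensionFunctor (e : S' ⊗ S ≅ 𝟙_ C) : DLie S ⥤ DPFreeQuad S :=
  freeFunctor S (DLie.extension e) fun φ => isBracketHom_map φ.isBracketHom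

variable (S) in
/-- Restriction to generators is inverse to the extension of brackets. -/
noncomputable def extensionEquivalence (e : S' ⊗ S ≅ 𝟙_ C) : DLie S ≌ DPFreeQuad S :=
  CategoryTheory.Equivalence.mk (extensionFunctor S e) (restrictFunctor S)
    (NatIso.ofComponents (fun L => DLie.isoOfEq (QuadBracket.restrict_extension e L).symm _ _)
      fun {L H} φ => DLie.Hom.ext (by
        change φ.hom ≫ 𝟙 _ = 𝟙 _ ≫ T.gen L.X ≫ T.map φ.hom ≫ T.proj H.X
        rw [Category.id_comp, Category.comp_id, reassoc_of% T.gen_map φ.hom, T.gen_proj,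
          Category.comp_id]))
    (NatIso.ofComponents (fun P => DPFreeQuad.isoOfEq P.str.extend_restrict)
      fun {P Q} h => DPFreeQuad.Hom.ext (by
        change T.map (T.gen P.X ≫ h.hom ≫ T.proj Q.X) ≫ 𝟙 _ = 𝟙 _ ≫ h.hom
        -- Being of the form `T(φ)` is what lets a morphism be recovered from its restriction to
        -- generators.
        obtain ⟨φ, hφ⟩ := h.induced
        rw [Category.id_comp, Category.comp_id, hφ, reassoc_of% T.gen_map φ, T.gen_proj,
          Category.comp_id]))

end Main

end DoubleBrackets

open DoubleBrackets
theorem mainTheorem4 {C : Type u} [Category.{v} C] [Preadditive C] [HasFiniteBiproducts C]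
    [MonoidalCategory C] [MonoidalPreadditive C] [SymmetricCategory C] [HasTensorAlgebras C]
    (S Sinv : C) (_e : Sinv ⊗ S ≅ 𝟙_ C) :
    ∃ (ext : ∀ L : DLie S, QuadBracket S L.X)
      (hext : ∀ {L H : DLie S} (φ : L ⟶ H),
        IsBracketHom S (ext L).bracket (ext H).bracket (T.map φ.hom)),
      (∀ L : DLie S, IsBracketHom S L.bracket (ext L).bracket (T.gen L.X) ∧
        ∀ f : DoubleBracket S (T L.X), IsAntisymmetric S f → IsLeftDerivation S f →
          IsBracketHom S L.bracket f (T.gen L.X) → f = (ext L).bracket) ∧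
      ∃ E : DLie S ≌ DPFreeQuad S,
        E.functor = freeFunctor S ext hext ∧ E.inverse = restrictFunctor S := by
  -- Biproducts are needed to form the comonoids `𝟙 ⊞ X`.
  have := hasBinaryBiproducts_of_finite_biproducts C
  exact ⟨DLie.extension _e, fun φ => isBracketHom_map φ.isBracketHom,
    fun L => ⟨isBracketHom_extend L.bracket, fun _ ha hl hg => eq_extend ha hl hg⟩,
    extensionEquivalence S _e, rfl, rfl⟩
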